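/- Let $\varrho_D$ be a probability measure on $D\subset\mathbb R^d$ (or on any measurable space $D$), and let $H(K)$ be a separable reproducing kernel Hilbert space of complex-valued functions on $D$, each of them $\varrho_D$-measurable, whose kernel satisfies $\sup_{x\in D}K(x,x)<\infty$. Let $\mathrm{Id}:H(K)\to L_2(D,\varrho_D)$ be the embedding, let $\lambda_1\ge\lambda_2\ge\dots>0$ be the positive eigenvalues of $\mathrm{Id}^*\circ\mathrm{Id}$ counted with multiplicity, let $e_1,e_2,\dots\in H(K)$ be corresponding $H(K)$-orthonormal eigenvectors, and put $\sigma_k=\sqrt{\lambda_k}$ and $\eta_k=\sigma_k^{-1}e_k$. If there are only finitely many, say $r$, positive eigenvalues, put $\lambda_k=\sigma_k=0$ and $e_k=0$ for $k>r$, and below only $m\le r+1$ is considered. For $m\in\mathbb N=\{1,2,\dots\}$ let $$N(m)=\sup_{x\in D}\sum_{k=1}^{m-1}|\eta_k(x)|^2,\qquad T(m)=\sup_{x\in D}\sum_{k=m}^{\infty}|e_k(x)|^2 .$$ For nodes $X=(x^1,\dots,x^n)\in D^n$ let $L_m(X)=(\eta_k(x^i))_{i=1,\dots,n;\,k=1,\dots,m-1}$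 and, if this matrix has full column rank $m-1$, let $$S^m_Xf=\sum_{k=1}^{m-1}c_k\eta_k,\qquad (c_1,\dots,c_{m-1})^\top=(L_m^*L_m)^{-1}L_m^*\,(f(x^1),\dots,f(x^n))^\top$$ be the least squares approximant of $f\in H(K)$. Let $0<\delta<1$ and $n,m\in\mathbb N$ be such that $$N(m)\le\frac{n}{48\,(\sqrt2\,\log(2n)-\log\delta)} ,$$ and let the nodes $x^1,\dots,x^n$ be drawn independently according to $\varrho_D$. Then with probability at least $1-3\delta$ the matrix $L_m(X)$ has full column rank and $$\sup_{\|f\|_{H(K)}\le1}\|f-S^m_Xf\|^2_{L_2(D,\varrho_D)}\le\frac{C}{\delta}\,\max\Big\{\sigma_m^2,\ \frac{\log(8n)}{n}\,T(m)\Big\} ;$$ in particular, this event is measurable with respect to the completion of the product measure $\varrho_D^n$. Here $C=3+8C_R^2+4C_R<28.05$ with $C_R=\sqrt2+\frac1{4\sqrt{2\log 8}}$. -/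

import Mathlib

open MeasureTheory
open scoped ENNReal Matrix

namespace RKHSLeastSquares

noncomputable section

/-- The scalar kernel `K(x, y)` of a reproducing kernel Hilbert space `H = H(K)` of complex-valued
functions on `D`; it satisfies `f y = ⟨K(·, y), f⟩` (inner product linear in the second slot). -/
def scalarKernel (H : Type*) {D : Type*} [NormedAddCommGroup H] [InnerProductSpace ℂ H]
    [CompleteSpace H] [RKHS ℂ H D ℂ] (x y : D) : ℂ :=
  RKHS.kernel H x y 1

/-- `sup_x K(x, x) < ∞`.  (The number `K(x, x)` is real and nonnegative, so it equals its norm.) -/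
def IsBoundedKernel (H : Type*) {D : Type*} [NormedAddCommGroup H] [InnerProductSpace ℂ H]
    [CompleteSpace H] [RKHS ℂ H D ℂ] : Prop :=
  BddAbove (Set.range fun x : D => ‖scalarKernel H x x‖)

theorem norm_apply_le_of_isBoundedKernel {H D : Type*} [NormedAddCommGroup H]
    [InnerProductSpace ℂ H] [CompleteSpace H] [RKHS ℂ H D ℂ] (hK : IsBoundedKernel H)
    (f : H) (x : D) : ‖f x‖ ≤ √(⨆ z : D, ‖scalarKernel H z z‖) * ‖f‖ := by
  have h1 := RKHS.norm_apply_le f x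
  have h2 : ‖RKHS.kernel H x x‖ = ‖scalarKernel H x x‖ := by
    have h3 : RKHS.kernel H x x = ContinuousLinearMap.toSpanSingleton ℂ (scalarKernel H x x) := by
      ext
      simp [scalarKernel]
    rw [h3, ContinuousLinearMap.norm_toSpanSingleton]
  rw [h2] at h1
  have h4 : ‖scalarKernel H x x‖ ≤ ⨆ z : D, ‖scalarKernel H z z‖ := le_ciSup hK x
  calc ‖f x‖ ≤ ‖f‖ * √‖scalarKernel H x x‖ := h1
    _ ≤ ‖f‖ * √(⨆ z : D, ‖scalarKernel H z z‖) := by gcongr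
    _ = _ := mul_comm _ _

theorem memLp_of_isBoundedKernel {H D : Type*} [MeasurableSpace D] [NormedAddCommGroup H]
    [InnerProductSpace ℂ H] [CompleteSpace H] [RKHS ℂ H D ℂ] (ρ : Measure D)
    [IsProbabilityMeasure ρ] (hmeas : ∀ f : H, AEStronglyMeasurable f ρ)
    (hK : IsBoundedKernel H) (f : H) : MemLp f 2 ρ :=
  MemLp.of_bound (hmeas f) _ (Filter.Eventually.of_forall (norm_apply_le_of_isBoundedKernel hK f))

/-- The embedding operator `Id : H(K) → L₂(D, ρ)`, sending a function to its class. -/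
def embedding {H D : Type*} [MeasurableSpace D] [NormedAddCommGroup H]
    [InnerProductSpace ℂ H] [CompleteSpace H] [RKHS ℂ H D ℂ] (ρ : Measure D)
    [IsProbabilityMeasure ρ] (hmeas : ∀ f : H, AEStronglyMeasurable f ρ)
    (hK : IsBoundedKernel H) : H →L[ℂ] Lp ℂ 2 ρ :=
  LinearMap.mkContinuous
    { toFun := fun f => (memLp_of_isBoundedKernel ρ hmeas hK f).toLp f
      map_add' := fun f g => by
        rw [← MemLp.toLp_add]
        exact MemLp.toLp_congr _ _ (by rw [RKHS.coe_add])
      map_smul' := fun c f => by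
        rw [RingHom.id_apply, ← MemLp.toLp_const_smul]
        exact MemLp.toLp_congr _ _ (by rw [RKHS.coe_smul]) }
    (√(⨆ z : D, ‖scalarKernel H z z‖))
    (fun f => by
      have h := Lp.norm_le_of_ae_bound
        (f := (memLp_of_isBoundedKernel ρ hmeas hK f).toLp f)
        (C := √(⨆ z : D, ‖scalarKernel H z z‖) * ‖f‖) (by positivity)
        ((MemLp.coeFn_toLp _).mono fun x hx => by
          rw [hx]
          exact norm_apply_le_of_isBoundedKernel hK f x)
      simpa [measureUnivNNReal] using h)

/-- `W = Id* ∘ Id : H(K) → H(K)`. -/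
def gramOperator {H D : Type*} [MeasurableSpace D] [NormedAddCommGroup H]
    [InnerProductSpace ℂ H] [CompleteSpace H] [RKHS ℂ H D ℂ] (ρ : Measure D)
    [IsProbabilityMeasure ρ] (hmeas : ∀ f : H, AEStronglyMeasurable f ρ)
    (hK : IsBoundedKernel H) : H →L[ℂ] H :=
  (embedding ρ hmeas hK).adjoint ∘L embedding ρ hmeas hK

/-- `(lam k, e k)`, `k = 0, 1, 2, …`, are the eigenpairs of `W` with positive eigenvalue, in
non-increasing order, each eigenvalue repeated according to its multiplicity, with orthonormal
eigenvectors.  If there are only finitely many of them, both sequences are continued by zero.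
The index `k` here is the index `k + 1` of the usual enumeration by `1, 2, 3, …`. -/
structure IsEigensystem {H : Type*} [NormedAddCommGroup H] [InnerProductSpace ℂ H]
    (W : H →L[ℂ] H) (lam : ℕ → ℝ) (e : ℕ → H) : Prop where
  nonneg : ∀ k, 0 ≤ lam k
  antitone : Antitone lam
  orthonormal : Orthonormal ℂ (fun k : {k : ℕ // 0 < lam k} => e k)
  eq_zero : ∀ k, lam k = 0 → e k = 0
  eigen : ∀ k, W (e k) = (lam k : ℂ) • e k
  complete : ∀ μ : ℝ, 0 < μ → ∀ f : H, W f = (μ : ℂ) • f →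
    f ∈ Submodule.span ℂ (e '' {k | lam k = μ})

/-- The singular number `σ_{k+1} = √λ_{k+1}` of the embedding (indices start at `0` here). -/
def singularNumber (lam : ℕ → ℝ) (k : ℕ) : ℝ := √(lam k)

/-- The `L₂`-normalized eigenfunction `η_{k+1} = λ_{k+1}^{-1/2} e_{k+1}`, as an element of `H(K)`
(indices start at `0` here). -/
def eta {H : Type*} [NormedAddCommGroup H] [InnerProductSpace ℂ H]
    (lam : ℕ → ℝ) (e : ℕ → H) (k : ℕ) : H :=
  (((√(lam k))⁻¹ : ℝ) : ℂ) • e k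

/-- `N(m) = sup_x ∑_{k=1}^{m-1} |η_k(x)|²`. -/
def spectralFunction {H D : Type*} [NormedAddCommGroup H] [InnerProductSpace ℂ H]
    [RKHS ℂ H D ℂ] (lam : ℕ → ℝ) (e : ℕ → H) (m : ℕ) : ℝ :=
  ⨆ x : D, ∑ k ∈ Finset.range (m - 1), ‖eta lam e k x‖ ^ 2

/-- `T(m) = sup_x ∑_{k=m}^∞ |e_k(x)|²`. -/
def tailFunction {H D : Type*} [NormedAddCommGroup H] [InnerProductSpace ℂ H]
    [RKHS ℂ H D ℂ] (e : ℕ → H) (m : ℕ) : ℝ :=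
  ⨆ x : D, ∑' k : ℕ, ‖e (m - 1 + k) x‖ ^ 2

/-- The `n × (m-1)` matrix `L_m(X) = (η_k(xⁱ))_{i,k}`. -/
def sampleMatrix {H D : Type*} [NormedAddCommGroup H] [InnerProductSpace ℂ H]
    [RKHS ℂ H D ℂ] (lam : ℕ → ℝ) (e : ℕ → H) (m : ℕ) {n : ℕ} (X : Fin n → D) :
    Matrix (Fin n) (Fin (m - 1)) ℂ :=
  Matrix.of fun i k => eta lam e k (X i)

/-- The least squares solution `(L* L)⁻¹ L* y` of `L c = y` (for `L` of full column rank). -/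
def leastSquares {n p : ℕ} (L : Matrix (Fin n) (Fin p) ℂ) (y : Fin n → ℂ) : Fin p → ℂ :=
  ((Lᴴ * L)⁻¹ * Lᴴ) *ᵥ y

/-- The least squares approximant `S^m_X f = ∑_{k=1}^{m-1} c_k η_k`, where `c` is the least squares
solution of `L_m(X) c = (f(x¹), …, f(xⁿ))`. -/
def approximant {H D : Type*} [NormedAddCommGroup H] [InnerProductSpace ℂ H]
    [RKHS ℂ H D ℂ] (lam : ℕ → ℝ) (e : ℕ → H) (m : ℕ) {n : ℕ} (X : Fin n → D) (f : H) : H :=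
  ∑ k : Fin (m - 1), leastSquares (sampleMatrix lam e m X) (fun i => f (X i)) k • eta lam e k

/-- The squared worst-case error `sup_{‖f‖ ≤ 1} ‖f - S^m_X f‖²` in `L₂(D, ρ)`, in `[0, ∞]`. -/
def worstCaseErrorSq {H D : Type*} [MeasurableSpace D] [NormedAddCommGroup H]
    [InnerProductSpace ℂ H] [CompleteSpace H] [RKHS ℂ H D ℂ] (ρ : Measure D)
    [IsProbabilityMeasure ρ] (hmeas : ∀ f : H, AEStronglyMeasurable f ρ)
    (hK : IsBoundedKernel H) (lam : ℕ → ℝ) (e : ℕ → H) (m : ℕ) {n : ℕ} (X : Fin n → D) : ℝ≥0∞ :=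
  ⨆ (f : H) (_ : ‖f‖ ≤ 1), ‖embedding ρ hmeas hK (f - approximant lam e m X f)‖ₑ ^ 2

/-- `C_R = √2 + 1 / (4 √(2 log 8))`. -/
def constR : ℝ := √2 + 1 / (4 * √(2 * Real.log 8))

/-- `C = 3 + 8 C_R² + 4 C_R`. -/
def constC : ℝ := 3 + 8 * constR ^ 2 + 4 * constR

end

end RKHSLeastSquares

/-! Write `f = P f + g`, with `P` the `H`-orthogonal projection onto the span of the first `m - 1`
eigenvectors. Least squares reproduces `P f`, so the error is `g` minus the least squares fit of
`g`, and these two parts are orthogonal in `L₂`. The first contributes at most `λ_m`. The second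
contributes at most `t / a`, where `a` bounds `L* L` from below and `t` bounds `∑ᵢ |g(xⁱ)|²` over
the unit ball of the orthogonal complement. It remains to show `a = n / 2` with failure probability
at most `2δ`, and `t = 10 n Q / δ` with failure probability at most `δ`, where `Q` is the maximum in
the error bound. The total is then at most `Q + 20 Q / δ ≤ 21 Q / δ`, and `21 ≤ C`.

Both estimates concern a sum `S` of independent rank-one matrices `Z(xⁱ) = y(xⁱ) y(xⁱ)*`. They
follow from Markov's inequality for trace moments of order about a logarithm, so that the prefactor
`n` is absorbed. The moments are controlled by exchangeable pairs: a sample is swapped with an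
independent copy, and a trace inequality for `(A - B)(A^(q+1) - B^(q+1))` gives a recursion in the
order (`integral_trace_sampleSum_mul_pow_le`). Diagonalising both matrices turns that inequality
into one for real numbers.

For the upper estimate the moments of `S` itself are used. Their bound depends on `∑ lam k ≤ B` but
not on the dimension, so it holds uniformly for all finite truncations of the eigenvector tail. For
the lower estimate the even moments of `S - n` contract by `n² / 11` per step.

Passing from truncations to all of `H` needs the eigenvectors to span everything visible to `L₂`.
The embedding is Hilbert–Schmidt because the kernel is bounded, so `Id* Id` is compact and vanishes
on the complement of its eigenvectors. Functions in its kernel are zero almost everywhere, and by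
separability almost surely all of them vanish at all nodes. -/

section
-- Trace inequalities for pairs of Hermitian matrices.
open scoped ComplexOrder

/-- With unitary eigenbases `U` and `V`, the weights are `|Q k l|²` for the unitary `Q = U* V`, so
they have row sums one. Trace inequalities for a non-commuting pair thereby reduce to inequalities
between pairs of eigenvalues. -/
theorem Matrix.IsHermitian.trace_pow_mul_pow {ι : Type*} [Fintype ι] [DecidableEq ι]
    {A B : Matrix ι ι ℂ} (hA : A.IsHermitian) (hB : B.IsHermitian) :
    ∃ (a b : ι → ℝ) (w : ι → ι → ℝ), (∀ k l, 0 ≤ w k l) ∧ (∀ k, ∑ l, w k l = 1) ∧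
      (A.PosSemidef → ∀ k, 0 ≤ a k) ∧ (B.PosSemidef → ∀ l, 0 ≤ b l) ∧
      ∀ i j : ℕ, (A ^ i * B ^ j).trace.re = ∑ k, ∑ l, w k l * (a k ^ i * b l ^ j) := by
  set U : Matrix ι ι ℂ := hA.eigenvectorUnitary.1 with hU
  set V : Matrix ι ι ℂ := hB.eigenvectorUnitary.1 with hV
  have hUU : Uᴴ * U = 1 := (Unitary.mem_iff.1 hA.eigenvectorUnitary.2).1
  have hUU' : U * Uᴴ = 1 := (Unitary.mem_iff.1 hA.eigenvectorUnitary.2).2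
  have hVV : Vᴴ * V = 1 := (Unitary.mem_iff.1 hB.eigenvectorUnitary.2).1
  have hVV' : V * Vᴴ = 1 := (Unitary.mem_iff.1 hB.eigenvectorUnitary.2).2
  have key : ∀ (C W : Matrix ι ι ℂ) (c : ι → ℝ), Wᴴ * W = 1 → W * Wᴴ = 1 →
      C = W * Matrix.diagonal (fun k => (c k : ℂ)) * Wᴴ → ∀ i : ℕ,
      C ^ i = W * Matrix.diagonal (fun k => ((c k ^ i : ℝ) : ℂ)) * Wᴴ := by
    intro C W c h1 h2 h3 i
    induction i with
    | zero => simp [h2]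
    | succ i ih =>
      rw [pow_succ]
      conv_lhs => rw [ih, h3]
      calc _ = W * Matrix.diagonal (fun k => ((c k ^ i : ℝ) : ℂ)) * (Wᴴ * W) *
            Matrix.diagonal (fun k => (c k : ℂ)) * Wᴴ := by simp only [Matrix.mul_assoc]
        _ = _ := by
          rw [h1, Matrix.mul_one, Matrix.mul_assoc W, Matrix.diagonal_mul_diagonal]
          congr 3
          ext k
          push_cast
          ring_nf
  have hA' := key A U hA.eigenvalues hUU hUU' (by
    conv_lhs => rw [hA.spectral_theorem]
    rfl)
  have hB' := key B V hB.eigenvalues hVV hVV' (by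
    conv_lhs => rw [hB.spectral_theorem]
    rfl)
  set Q := Uᴴ * V with hQ
  have hQQ : Q * Qᴴ = 1 := by
    rw [hQ, Matrix.conjTranspose_mul, Matrix.conjTranspose_conjTranspose]
    calc _ = Uᴴ * (V * Vᴴ) * U := by simp only [Matrix.mul_assoc]
      _ = 1 := by rw [hVV', Matrix.mul_one, hUU]
  refine ⟨hA.eigenvalues, hB.eigenvalues, fun k l => ‖Q k l‖ ^ 2, fun k l => by positivity, ?_,
    fun h => h.eigenvalues_nonneg, fun h => h.eigenvalues_nonneg, ?_⟩
  · intro k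
    have h := congrFun (congrFun hQQ k) k
    simp only [Matrix.mul_apply, Matrix.conjTranspose_apply, Matrix.one_apply_eq] at h
    have h2 : ((∑ l, ‖Q k l‖ ^ 2 : ℝ) : ℂ) = 1 := by
      rw [← h]
      push_cast
      refine Finset.sum_congr rfl fun l _ => ?_
      exact (Complex.mul_conj' _).symm
    exact_mod_cast h2
  · intro i j
    have h : (A ^ i * B ^ j).trace = ((∑ k, ∑ l, ‖Q k l‖ ^ 2 *
        (hA.eigenvalues k ^ i * hB.eigenvalues l ^ j) : ℝ) : ℂ) := by
      rw [hA', hB']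
      have h1 : (U * Matrix.diagonal (fun k => ((hA.eigenvalues k ^ i : ℝ) : ℂ)) * Uᴴ *
          (V * Matrix.diagonal (fun k => ((hB.eigenvalues k ^ j : ℝ) : ℂ)) * Vᴴ)).trace =
          (Matrix.diagonal (fun k => ((hA.eigenvalues k ^ i : ℝ) : ℂ)) * Q *
            (Matrix.diagonal (fun k => ((hB.eigenvalues k ^ j : ℝ) : ℂ)) * Qᴴ)).trace := by
        rw [hQ, Matrix.conjTranspose_mul, Matrix.conjTranspose_conjTranspose]
        simp only [Matrix.mul_assoc]
        rw [Matrix.trace_mul_comm]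
        simp only [Matrix.mul_assoc]
      rw [h1]
      simp only [Matrix.trace, Matrix.diag_apply, Matrix.mul_apply (M := _ * Q),
        Matrix.diagonal_mul, Matrix.conjTranspose_apply]
      push_cast
      refine Finset.sum_congr rfl fun k _ => Finset.sum_congr rfl fun l _ => ?_
      rw [← Complex.mul_conj' (Q k l)]
      simp only [RCLike.star_def]
      ring
    rw [h, Complex.ofReal_re]

/-- Factor `a^(q+1) - b^(q+1)` as `(a - b) ∑ a^i b^(q-i)` and pair `i` with `q - i`. Each pair is at
most `a^q + b^q`, because `|a|^i - |b|^i` and `|a|^j - |b|^j` have the same sign. -/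
theorem sub_mul_pow_sub_pow_le {a b : ℝ} {q : ℕ} (ha : |a| ^ q = a ^ q) (hb : |b| ^ q = b ^ q) :
    (a - b) * (a ^ (q + 1) - b ^ (q + 1)) ≤ (q + 1) / 2 * ((a - b) ^ 2 * (a ^ q + b ^ q)) := by
  have h1 := geom_sum₂_mul a b (q + 1)
  set s := ∑ i ∈ Finset.range (q + 1), a ^ i * b ^ (q + 1 - 1 - i) with hs
  have h2 : s ≤ ∑ i ∈ Finset.range (q + 1), |a| ^ i * |b| ^ (q - i) := by
    refine Finset.sum_le_sum fun i _ => ?_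
    rw [← abs_pow, ← abs_pow, ← abs_mul]
    exact le_abs_self _
  have h3 : ∑ i ∈ Finset.range (q + 1), |a| ^ i * |b| ^ (q - i) =
      ∑ i ∈ Finset.range (q + 1), |a| ^ (q - i) * |b| ^ i := by
    rw [← Finset.sum_range_reflect]
    refine Finset.sum_congr rfl fun i hi => ?_
    have : i ≤ q := by simpa [Nat.lt_succ_iff] using hi
    congr 2
    omega
  have h4 : ∑ i ∈ Finset.range (q + 1), |a| ^ i * |b| ^ (q - i) +
      ∑ i ∈ Finset.range (q + 1), |a| ^ (q - i) * |b| ^ i ≤ (q + 1) * (a ^ q + b ^ q) := by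
    rw [← Finset.sum_add_distrib]
    calc _ ≤ ∑ i ∈ Finset.range (q + 1), (a ^ q + b ^ q) := by
          refine Finset.sum_le_sum fun i hi => ?_
          have hi : i ≤ q := by simpa [Nat.lt_succ_iff] using hi
          rw [← ha, ← hb]
          obtain ⟨j, rfl⟩ := Nat.exists_eq_add_of_le hi
          rw [Nat.add_sub_cancel_left]
          have : 0 ≤ (|a| ^ i - |b| ^ i) * (|a| ^ j - |b| ^ j) := by
            rcases le_total |a| |b| with h | h
            · exact mul_nonneg_of_nonpos_of_nonpos
                (sub_nonpos.2 (pow_le_pow_left₀ (abs_nonneg _) h _))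
                (sub_nonpos.2 (pow_le_pow_left₀ (abs_nonneg _) h _))
            · exact mul_nonneg (sub_nonneg.2 (pow_le_pow_left₀ (abs_nonneg _) h _))
                (sub_nonneg.2 (pow_le_pow_left₀ (abs_nonneg _) h _))
          rw [pow_add, pow_add]
          linarith
      _ = _ := by simp [mul_add]
  have h5 : s ≤ (q + 1) / 2 * (a ^ q + b ^ q) := by linarith
  rw [← h1]
  calc (a - b) * (s * (a - b)) = (a - b) ^ 2 * s := by ring
    _ ≤ (a - b) ^ 2 * ((q + 1) / 2 * (a ^ q + b ^ q)) := by gcongr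
    _ = _ := by ring

/-- By cyclicity both sides expand into traces `tr (A^i B^j)`, hence into the same weighted averages
over pairs of eigenvalues, and the scalar inequality applies to each pair. -/
theorem Matrix.trace_sub_mul_pow_sub_pow_le {ι : Type*} [Fintype ι] [DecidableEq ι]
    {A B : Matrix ι ι ℂ} (hA : A.IsHermitian) (hB : B.IsHermitian) {q : ℕ}
    (h : Even q ∨ A.PosSemidef ∧ B.PosSemidef) :
    ((A - B) * (A ^ (q + 1) - B ^ (q + 1))).trace.re ≤
      (q + 1) / 2 * (((A - B) ^ 2 * (A ^ q + B ^ q)).trace.re) := by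
  obtain ⟨a, b, w, hw, -, ha, hb, key⟩ := hA.trace_pow_mul_pow hB
  have e1 : ((A - B) * (A ^ (q + 1) - B ^ (q + 1))).trace.re =
      (A ^ (q + 2) * B ^ 0).trace.re - (A ^ 1 * B ^ (q + 1)).trace.re -
        (A ^ (q + 1) * B ^ 1).trace.re + (A ^ 0 * B ^ (q + 2)).trace.re := by
    have : (A - B) * (A ^ (q + 1) - B ^ (q + 1)) =
      A ^ (q + 2) - A * B ^ (q + 1) - B * A ^ (q + 1) + B ^ (q + 2) := by
      rw [pow_succ' A (q + 1), pow_succ' B (q + 1)]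
      noncomm_ring
    rw [this]
    simp only [Matrix.trace_add, Matrix.trace_sub, Complex.add_re, Complex.sub_re, pow_zero,
      mul_one, one_mul, pow_one]
    rw [Matrix.trace_mul_comm B]
  have e2 : ((A - B) ^ 2 * (A ^ q + B ^ q)).trace.re =
      (A ^ (q + 2) * B ^ 0).trace.re - 2 * (A ^ (q + 1) * B ^ 1).trace.re +
      (A ^ q * B ^ 2).trace.re + (A ^ 2 * B ^ q).trace.re - 2 * (A ^ 1 * B ^ (q + 1)).trace.re +
      (A ^ 0 * B ^ (q + 2)).trace.re := by
    have : (A - B) ^ 2 * (A ^ q + B ^ q) =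
      A ^ (q + 2) - A * (B * A ^ q) - B * A ^ (q + 1) + B ^ 2 * A ^ q + A ^ 2 * B ^ q
        - A * B ^ (q + 1) - B * (A * B ^ q) + B ^ (q + 2) := by
      rw [pow_succ' A (q + 1), pow_succ' B (q + 1), pow_succ' A q, pow_succ' B q]
      noncomm_ring
    rw [this]
    simp only [Matrix.trace_add, Matrix.trace_sub, Complex.add_re, Complex.sub_re, pow_zero,
      mul_one, one_mul, pow_one]
    rw [Matrix.trace_mul_comm B (A * B ^ q), Matrix.trace_mul_comm A (B * A ^ q),
      Matrix.trace_mul_comm B (A ^ (q + 1)), Matrix.trace_mul_comm (B ^ 2), Matrix.mul_assoc B,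
      Matrix.mul_assoc A, ← pow_succ, ← pow_succ, Matrix.trace_mul_comm B (A ^ (q + 1))]
    ring
  rw [e1, e2]
  simp only [key, Finset.mul_sum, ← Finset.sum_sub_distrib, ← Finset.sum_add_distrib]
  refine Finset.sum_le_sum fun k _ => Finset.sum_le_sum fun l _ => ?_
  have h3 : (a k - b l) * (a k ^ (q + 1) - b l ^ (q + 1)) ≤
      (q + 1) / 2 * ((a k - b l) ^ 2 * (a k ^ q + b l ^ q)) := by
    rcases h with h | ⟨h, h'⟩
    · exact sub_mul_pow_sub_pow_le (h.pow_abs _) (h.pow_abs _)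
    · exact sub_mul_pow_sub_pow_le (by rw [abs_of_nonneg (ha h k)])
        (by rw [abs_of_nonneg (hb h' l)])
  have h4 := mul_le_mul_of_nonneg_left h3 (hw k l)
  calc _ = w k l * ((a k - b l) * (a k ^ (q + 1) - b l ^ (q + 1))) := by ring
    _ ≤ _ := h4
    _ = _ := by ring

/-- `⟨c, A c⟩` is bounded by any `s` with `tr A ^ p < s ^ p`. -/
theorem Matrix.IsHermitian.abs_trace_mul_le_of_trace_pow_lt {ι : Type*} [Fintype ι]
    [DecidableEq ι] {A B : Matrix ι ι ℂ} (hA : A.IsHermitian) (hB : B.PosSemidef) {p : ℕ} {s : ℝ}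
    (hs : 0 ≤ s) (hp : Even p ∨ A.PosSemidef) (h : (A ^ p).trace.re < s ^ p) :
    |(A * B).trace.re| ≤ s * B.trace.re := by
  obtain ⟨a, b, w, hw, hw1, ha, hb, key⟩ := hA.trace_pow_mul_pow hB.isHermitian
  have hap : ∀ k, |a k| ^ p = a k ^ p := by
    intro k
    rcases hp with hp | hp
    · exact hp.pow_abs _
    · rw [abs_of_nonneg (ha hp k)]
  have h1 : (A ^ p).trace.re = ∑ k, |a k| ^ p := by
    have := key p 0
    simp only [pow_zero, mul_one, ← Finset.sum_mul, hw1, one_mul] at this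
    simp only [this, hap]
  -- A single `|a k|^p` is at most the sum of all of them, which is `tr A^p < s^p`.
  have h2 : ∀ k, |a k| ≤ s := by
    intro k
    refine (lt_of_pow_lt_pow_left₀ p hs (lt_of_le_of_lt ?_ h)).le
    rw [h1]
    exact Finset.single_le_sum (f := fun k => |a k| ^ p) (fun k _ => by positivity)
      (Finset.mem_univ k)
  have h3 := key 1 1
  have h4 := key 0 1
  simp only [pow_one, pow_zero, one_mul] at h3 h4
  rw [h3, h4, Finset.mul_sum]
  refine (Finset.abs_sum_le_sum_abs _ _).trans (Finset.sum_le_sum fun k _ => ?_)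
  rw [Finset.mul_sum]
  refine (Finset.abs_sum_le_sum_abs _ _).trans (Finset.sum_le_sum fun l _ => ?_)
  rw [abs_mul, abs_mul, abs_of_nonneg (hw k l), abs_of_nonneg (hb hB l)]
  calc w k l * (|a k| * b l) ≤ w k l * (s * b l) :=
        mul_le_mul_of_nonneg_left (mul_le_mul_of_nonneg_right (h2 k) (hb hB l)) (hw k l)
    _ = _ := by ring

/-- A matrix-valued function whose entries are essentially bounded. -/
def MatrixMemLpTop {Ω ι : Type*} [MeasurableSpace Ω] (M : Ω → Matrix ι ι ℂ) (μ : Measure Ω) :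
    Prop :=
  ∀ k l, MemLp (fun ω => M ω k l) ∞ μ

/-! ### Integrability of matrix-valued functions. -/

namespace MatrixMemLpTop

variable {Ω Ω' ι : Type*} [MeasurableSpace Ω] [MeasurableSpace Ω'] {μ : Measure Ω}
  {μ' : Measure Ω'} {M N : Ω → Matrix ι ι ℂ}

theorem const [IsFiniteMeasure μ] (C : Matrix ι ι ℂ) : MatrixMemLpTop (fun _ => C) μ :=
  fun k l => memLp_const (C k l)

theorem add (hM : MatrixMemLpTop M μ) (hN : MatrixMemLpTop N μ) :
    MatrixMemLpTop (fun ω => M ω + N ω) μ :=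
  fun k l => (hM k l).add (hN k l)

theorem sub (hM : MatrixMemLpTop M μ) (hN : MatrixMemLpTop N μ) :
    MatrixMemLpTop (fun ω => M ω - N ω) μ :=
  fun k l => (hM k l).sub (hN k l)

theorem sum {κ : Type*} (s : Finset κ) {M : κ → Ω → Matrix ι ι ℂ}
    (hM : ∀ i ∈ s, MatrixMemLpTop (M i) μ) : MatrixMemLpTop (fun ω => ∑ i ∈ s, M i ω) μ := by
  intro k l
  simp only [Matrix.sum_apply]
  exact memLp_finsetSum s fun i hi => hM i hi k l

theorem mul [Fintype ι] (hM : MatrixMemLpTop M μ) (hN : MatrixMemLpTop N μ) :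
    MatrixMemLpTop (fun ω => M ω * N ω) μ := by
  intro k l
  simp only [Matrix.mul_apply]
  exact memLp_finsetSum _ fun i _ => (hN i l).mul' (hM k i)

theorem pow [Fintype ι] [DecidableEq ι] [IsFiniteMeasure μ] (hM : MatrixMemLpTop M μ) (p : ℕ) :
    MatrixMemLpTop (fun ω => M ω ^ p) μ := by
  induction p with
  | zero => simpa using const 1
  | succ p ih => simpa only [pow_succ] using ih.mul hM

theorem comp {f : Ω' → Ω} (hM : MatrixMemLpTop M μ) (hf : MeasurePreserving f μ' μ) :
    MatrixMemLpTop (fun ω => M (f ω)) μ' :=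
  fun k l => (hM k l).comp_measurePreserving hf

theorem integrable_trace_re [Fintype ι] [IsFiniteMeasure μ] (hM : MatrixMemLpTop M μ) :
    Integrable (fun ω => (M ω).trace.re) μ := by
  refine Integrable.re (𝕜 := ℂ) (f := fun ω => (M ω).trace) ?_
  simp only [Matrix.trace, Matrix.diag_apply]
  exact integrable_finsetSum _ fun k _ => (hM k k).integrable le_top

end MatrixMemLpTop

/-- The matrix `∑ᵢ Z(xᵢ)`. -/
def sampleSum {D ι : Type*} (Z : D → Matrix ι ι ℂ) {n : ℕ} (X : Fin n → D) : Matrix ι ι ℂ :=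
  ∑ i, Z (X i)

/-! ### Exchangeable pairs for sums over independent samples. -/

section Exchange

variable {D ι : Type*} [MeasurableSpace D] {ρ : Measure D} [IsProbabilityMeasure ρ] {n : ℕ}

theorem measurePreserving_succ_coords (ρ : Measure D) [IsProbabilityMeasure ρ] (n : ℕ) :
    MeasurePreserving (fun (X : Fin (n + 1) → D) (i : Fin n) => X i.succ)
      (Measure.pi fun _ => ρ) (Measure.pi fun _ => ρ) :=
  measurePreserving_snd.comp (measurePreserving_piFinSuccAbove (fun _ : Fin (n + 1) => ρ) 0)

theorem measurePreserving_comp_perm (ρ : Measure D) [IsProbabilityMeasure ρ]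
    (e : Equiv.Perm (Fin n)) :
    MeasurePreserving (fun X : Fin n → D => X ∘ e)
      (Measure.pi fun _ => ρ) (Measure.pi fun _ => ρ) := by
  have := measurePreserving_piCongrLeft (fun _ : Fin n => ρ) e.symm
  convert this using 1
  ext X i
  obtain ⟨j, rfl⟩ := e.symm.surjective i
  simp [MeasurableEquiv.coe_piCongrLeft, Equiv.piCongrLeft_apply_apply]

theorem integral_comp_perm (e : Equiv.Perm (Fin n)) {F : (Fin n → D) → ℝ}
    (hF : Integrable F (Measure.pi fun _ => ρ)) :
    ∫ X, F (X ∘ e) ∂(Measure.pi fun _ : Fin n => ρ) = ∫ X, F X ∂(Measure.pi fun _ : Fin n => ρ) := by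
  have h := measurePreserving_comp_perm ρ e
  conv_rhs => rw [← h.map_eq]
  rw [integral_map h.aemeasurable (by rw [h.map_eq]; exact hF.1)]

theorem integral_succ_coords {F : (Fin n → D) → ℝ} (hF : Integrable F (Measure.pi fun _ => ρ)) :
    ∫ X, F (fun i => X i.succ) ∂(Measure.pi fun _ : Fin (n + 1) => ρ) =
      ∫ X, F X ∂(Measure.pi fun _ : Fin n => ρ) := by
  have h := measurePreserving_succ_coords ρ n
  conv_rhs => rw [← h.map_eq]
  rw [integral_map h.aemeasurable (by rw [h.map_eq]; exact hF.1)]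

theorem integral_mul_succ_coords (f : D → ℂ) (g : (Fin n → D) → ℂ) :
    ∫ X, f (X 0) * g (fun i => X i.succ) ∂(Measure.pi fun _ : Fin (n + 1) => ρ) =
      (∫ x, f x ∂ρ) * ∫ X, g X ∂(Measure.pi fun _ : Fin n => ρ) := by
  have h := measurePreserving_piFinSuccAbove (fun _ : Fin (n + 1) => ρ) 0
  rw [← integral_prod_mul]
  rw [← h.integral_comp' (g := fun z : D × (Fin n → D) => f z.1 * g z.2)]
  rfl

theorem MatrixMemLpTop.sampleSum {Z : D → Matrix ι ι ℂ} (hZ : MatrixMemLpTop Z ρ) :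
    MatrixMemLpTop (fun X : Fin n → D => sampleSum Z X) (Measure.pi fun _ => ρ) :=
  MatrixMemLpTop.sum _ fun i _ => hZ.comp (measurePreserving_eval _ i)

/-- The sum over coordinates `1, …, n` before and after the swap forms the exchangeable pair: the
two differ by replacing one sample with the spare one. -/
theorem sampleSum_swap {E : Type*} (Z : E → Matrix ι ι ℂ) (X : Fin (n + 1) → E) (i : Fin n) :
    sampleSum Z (fun j : Fin n => (X ∘ Equiv.swap 0 i.succ) j.succ) =
      sampleSum Z (fun j : Fin n => X j.succ) - Z (X i.succ) + Z (X 0) := by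
  have h : ∀ j : Fin n, (X ∘ Equiv.swap 0 i.succ) j.succ = if j = i then X 0 else X j.succ := by
    intro j
    by_cases hj : j = i
    · simp [hj]
    · simp only [Function.comp, hj, if_false]
      rw [Equiv.swap_apply_of_ne_of_ne (Fin.succ_ne_zero j) (by simpa using hj)]
  simp only [sampleSum, h]
  rw [← Finset.add_sum_erase _ _ (Finset.mem_univ i),
    ← Finset.add_sum_erase _ (fun j => Z (X j.succ)) (Finset.mem_univ i)]
  rw [Finset.sum_congr rfl (g := fun j => Z (X j.succ)) fun j hj => by
    rw [if_neg (Finset.ne_of_mem_erase hj)]]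
  simp [add_comm]

variable [Fintype ι]

/-- The spare sample `X 0` is independent of the others, so `Z (X 0)` may be replaced by its mean,
the diagonal matrix of `lam`. -/
theorem integral_trace_mul_succ_coords {Z : D → Matrix ι ι ℂ} (hZ : MatrixMemLpTop Z ρ)
    {lam : ι → ℝ} [DecidableEq ι]
    (hlam : ∀ k l, ∫ x, Z x k l ∂ρ = if k = l then (lam k : ℂ) else 0)
    {M : (Fin n → D) → Matrix ι ι ℂ} (hM : MatrixMemLpTop M (Measure.pi fun _ => ρ)) :
    ∫ X, (Z (X 0) * M (fun i => X i.succ)).trace.re ∂(Measure.pi fun _ : Fin (n + 1) => ρ) =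
      ∑ k, lam k * ∫ X, (M X k k).re ∂(Measure.pi fun _ : Fin n => ρ) := by
  have hZ0 : MatrixMemLpTop (fun X : Fin (n + 1) → D => Z (X 0)) (Measure.pi fun _ => ρ) :=
    hZ.comp (measurePreserving_eval _ 0)
  have hM0 : MatrixMemLpTop (fun X : Fin (n + 1) → D => M (fun i => X i.succ))
    (Measure.pi fun _ => ρ) := hM.comp (measurePreserving_succ_coords ρ n)
  have hint : ∀ k l, Integrable (fun X : Fin (n + 1) → D =>
      Z (X 0) k l * M (fun i => X i.succ) l k) (Measure.pi fun _ => ρ) := fun k l =>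
    ((hM0 l k).mul' (r := ∞) (hZ0 k l)).integrable le_top
  have h1 : ∫ X, (Z (X 0) * M (fun i => X i.succ)).trace ∂(Measure.pi fun _ : Fin (n + 1) => ρ) =
      ∑ k, (lam k : ℂ) * ∫ X, M X k k ∂(Measure.pi fun _ : Fin n => ρ) := by
    simp only [Matrix.trace, Matrix.diag_apply, Matrix.mul_apply]
    rw [integral_finsetSum _ fun k _ => integrable_finsetSum _ fun l _ => hint k l]
    refine Finset.sum_congr rfl fun k _ => ?_
    rw [integral_finsetSum _ fun l _ => hint k l]
    have : ∀ l, ∫ X, Z (X 0) k l * M (fun i => X i.succ) l k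
        ∂(Measure.pi fun _ : Fin (n + 1) => ρ) =
        if k = l then (lam k : ℂ) * ∫ X, M X l k ∂(Measure.pi fun _ : Fin n => ρ) else 0 := by
      intro l
      rw [integral_mul_succ_coords (fun x => Z x k l) (fun X => M X l k), hlam]
      split_ifs <;> simp
    simp [this]
  have h2 := congrArg Complex.re h1
  have h3 : ∀ {m : ℕ} {f : (Fin m → D) → ℂ}, Integrable f (Measure.pi fun _ => ρ) →
      (∫ X, f X ∂(Measure.pi fun _ : Fin m => ρ)).re =
        ∫ X, (f X).re ∂(Measure.pi fun _ : Fin m => ρ) := fun hf => (integral_re hf).symm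
  rw [h3] at h2
  · rw [h2, Complex.re_sum]
    refine Finset.sum_congr rfl fun k _ => ?_
    rw [Complex.re_ofReal_mul, h3 ((hM k k).integrable le_top)]
  · simp only [Matrix.trace, Matrix.diag_apply, Matrix.mul_apply]
    exact integrable_finsetSum _ fun k _ => integrable_finsetSum _ fun l _ => hint k l

/-- The exchangeable pairs inequality: replacing one sample by an independent copy `X 0`. -/
theorem integral_trace_sampleSum_mul_pow_le [DecidableEq ι] {Z : D → Matrix ι ι ℂ}
    (hZ : MatrixMemLpTop Z ρ)
    (hherm : ∀ x, (Z x).IsHermitian) {C : Matrix ι ι ℂ} (hC : C.IsHermitian) {q : ℕ}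
    (hq : Even q ∨ ∀ X : Fin n → D, (sampleSum Z X - C).PosSemidef) :
    ∫ X, (sampleSum Z X * (sampleSum Z X - C) ^ (q + 1)).trace.re
        ∂(Measure.pi fun _ : Fin n => ρ) ≤
      n * ∫ X, (Z (X 0) * (sampleSum Z (fun j : Fin n => X j.succ) - C) ^ (q + 1)).trace.re
        ∂(Measure.pi fun _ : Fin (n + 1) => ρ) +
      (q + 1) / 2 * ∑ i : Fin n, ∫ X, ((Z (X i.succ) - Z (X 0)) ^ 2 *
        (sampleSum Z (fun j : Fin n => X j.succ) - C) ^ q).trace.re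
        ∂(Measure.pi fun _ : Fin (n + 1) => ρ) := by
  set μ := Measure.pi fun _ : Fin (n + 1) => ρ with hμ
  set Δ : (Fin (n + 1) → D) → Matrix ι ι ℂ :=
    fun X => sampleSum Z (fun j : Fin n => X j.succ) - C with hΔ
  have hZi : ∀ i : Fin (n + 1), MatrixMemLpTop (fun X : Fin (n + 1) → D => Z (X i)) μ := fun i =>
    hZ.comp (measurePreserving_eval _ i)
  have hΔm : MatrixMemLpTop Δ μ :=
    (hZ.sampleSum.comp (measurePreserving_succ_coords ρ n)).sub (.const _)
  have hΔh : ∀ X, (Δ X).IsHermitian := fun X => by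
    refine Matrix.IsHermitian.sub ?_ hC
    rw [Matrix.IsHermitian, sampleSum, Matrix.conjTranspose_sum]
    exact Finset.sum_congr rfl fun i _ => hherm _
  have hstep : ∀ i : Fin n, ∫ X, (Z (X i.succ) * Δ X ^ (q + 1)).trace.re ∂μ ≤
      ∫ X, (Z (X 0) * Δ X ^ (q + 1)).trace.re ∂μ +
      (q + 1) / 2 * ∫ X, ((Z (X i.succ) - Z (X 0)) ^ 2 * Δ X ^ q).trace.re ∂μ := by
    intro i
    set σ : Equiv.Perm (Fin (n + 1)) := Equiv.swap 0 i.succ with hσ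
    set F : (Fin (n + 1) → D) → ℝ :=
      fun X => ((Z (X i.succ) - Z (X 0)) * Δ X ^ (q + 1)).trace.re with hF
    set G : (Fin (n + 1) → D) → ℝ :=
      fun X => ((Z (X i.succ) - Z (X 0)) ^ 2 * Δ X ^ q).trace.re with hG
    have hFi : Integrable F μ := (((hZi _).sub (hZi _)).mul (hΔm.pow _)).integrable_trace_re
    have hGi : Integrable G μ :=
      ((((hZi _).sub (hZi _)).pow 2).mul (hΔm.pow _)).integrable_trace_re
    have hFs := integral_comp_perm σ hFi
    have hGs := integral_comp_perm σ hGi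
    have hFi' : Integrable (fun X => F (X ∘ σ)) μ :=
      (measurePreserving_comp_perm ρ σ).integrable_comp_of_integrable hFi
    have hGi' : Integrable (fun X => G (X ∘ σ)) μ :=
      (measurePreserving_comp_perm ρ σ).integrable_comp_of_integrable hGi
    -- The swap negates `Z (X i.succ) - Z (X 0)`, which equals `Δ X - Δ (X ∘ σ)`. Hence the left
    -- side is the trace of `(A - B)(A^(q+1) - B^(q+1))` for these two deviations.
    have hpt : ∀ X, F X + F (X ∘ σ) ≤ (q + 1) / 2 * (G X + G (X ∘ σ)) := by
      intro X
      have h1 : Δ (X ∘ σ) = Δ X - Z (X i.succ) + Z (X 0) := by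
        simp only [hΔ, hσ, sampleSum_swap]
        abel
      have h2 : Z (X i.succ) - Z (X 0) = Δ X - Δ (X ∘ σ) := by rw [h1]; abel
      have h3 : Z ((X ∘ σ) i.succ) - Z ((X ∘ σ) 0) = -(Δ X - Δ (X ∘ σ)) := by
        rw [← h2]
        simp [hσ]
      have h4 := Matrix.trace_sub_mul_pow_sub_pow_le (hΔh X) (hΔh (X ∘ σ)) (q := q)
        (hq.imp id fun h => ⟨h _, h _⟩)
      simp only [hF, hG, h3, h2, neg_sq, neg_mul, Matrix.trace_neg, Complex.neg_re]
      rw [mul_sub, mul_add] at h4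
      simp only [Matrix.trace_sub, Matrix.trace_add, Complex.sub_re, Complex.add_re] at h4
      linarith
    -- The swap preserves the measure, so after integration both sides are doubled and the factors
    -- cancel.
    have h5 := integral_mono (hFi.add hFi') ((hGi.add hGi').const_mul ((q + 1) / 2 : ℝ)) hpt
    simp only [Pi.add_apply] at h5
    rw [integral_add hFi hFi', integral_const_mul, integral_add hGi hGi', hFs, hGs] at h5
    have h6 : ∫ X, F X ∂μ = ∫ X, (Z (X i.succ) * Δ X ^ (q + 1)).trace.re ∂μ -
        ∫ X, (Z (X 0) * Δ X ^ (q + 1)).trace.re ∂μ := by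
      rw [← integral_sub ((hZi _).mul (hΔm.pow _)).integrable_trace_re
        ((hZi _).mul (hΔm.pow _)).integrable_trace_re]
      simp only [hF, sub_mul, Matrix.trace_sub, Complex.sub_re]
    linarith
  have hS : ∫ X, (sampleSum Z X * (sampleSum Z X - C) ^ (q + 1)).trace.re
        ∂(Measure.pi fun _ : Fin n => ρ) =
      ∑ i : Fin n, ∫ X, (Z (X i.succ) * Δ X ^ (q + 1)).trace.re ∂μ := by
    rw [← integral_finsetSum _ fun i _ => ((hZi _).mul (hΔm.pow _)).integrable_trace_re,
      ← integral_succ_coords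
        (hZ.sampleSum.mul ((hZ.sampleSum.sub (.const C)).pow _)).integrable_trace_re]
    congr 1
    ext X
    rw [← Complex.re_sum, ← Matrix.trace_sum, ← Finset.sum_mul]
    rfl
  rw [hS]
  refine (Finset.sum_le_sum fun i _ => hstep i).trans_eq ?_
  rw [Finset.sum_add_distrib, Finset.mul_sum]
  simp [hΔ]

end Exchange
-- Positive semidefinite and rank-one matrices.
theorem Matrix.PosSemidef.trace_mul_re_nonneg {ι : Type*} [Fintype ι] [DecidableEq ι]
    {A B : Matrix ι ι ℂ} (hA : A.PosSemidef) (hB : B.PosSemidef) : 0 ≤ (A * B).trace.re := by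
  obtain ⟨a, b, w, hw, -, ha, hb, key⟩ := hA.isHermitian.trace_pow_mul_pow hB.isHermitian
  have h := key 1 1
  simp only [pow_one] at h
  rw [h]
  exact Finset.sum_nonneg fun k _ => Finset.sum_nonneg fun l _ =>
    mul_nonneg (hw k l) (mul_nonneg (ha hA k) (hb hB l))

theorem Matrix.IsHermitian.posSemidef_pow_of_even {ι : Type*} [Fintype ι] [DecidableEq ι]
    {A : Matrix ι ι ℂ} (hA : A.IsHermitian) {q : ℕ} (hq : Even q) : (A ^ q).PosSemidef := by
  obtain ⟨r, rfl⟩ := hq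
  rw [pow_add]
  have h := Matrix.posSemidef_conjTranspose_mul_self (A ^ r)
  rwa [(hA.pow r).eq] at h

/-- The rank-one matrix `v v*`. -/
def rankOne {ι : Type*} (v : ι → ℂ) : Matrix ι ι ℂ := Matrix.vecMulVec v (star v)

section RankOne

variable {ι : Type*} (v : ι → ℂ)

theorem rankOne_posSemidef [Finite ι] : (rankOne v).PosSemidef := Matrix.posSemidef_vecMulVec_self_star v

theorem trace_rankOne [Fintype ι] : (rankOne v).trace.re = ∑ k, ‖v k‖ ^ 2 := by
  simp only [rankOne, Matrix.trace, Matrix.diag_apply, Matrix.vecMulVec_apply, Complex.re_sum]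
  refine Finset.sum_congr rfl fun k _ => ?_
  have : v k * star v k = ((‖v k‖ ^ 2 : ℝ) : ℂ) := by
    push_cast
    exact Complex.mul_conj' _
  rw [this, Complex.ofReal_re]

theorem rankOne_sq [Fintype ι] [DecidableEq ι] :
    rankOne v ^ 2 = ((∑ k, ‖v k‖ ^ 2 : ℝ) : ℂ) • rankOne v := by
  rw [pow_two, rankOne, Matrix.vecMulVec_mul_vecMulVec]
  have : star v ⬝ᵥ v = ((∑ k, ‖v k‖ ^ 2 : ℝ) : ℂ) := by
    push_cast
    exact Finset.sum_congr rfl fun k _ => Complex.conj_mul' _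
  rw [this]
  ext k l
  simp [Matrix.vecMulVec_apply, mul_left_comm]

/-- Since `(v v*)² = ‖v‖² v v*`, a square can be traded for a factor `B`. This is how the uniform
bound enters the moment recursions. -/
theorem trace_rankOne_sq_mul_le [Fintype ι] [DecidableEq ι] {B : ℝ} (hB : ∑ k, ‖v k‖ ^ 2 ≤ B)
    {P : Matrix ι ι ℂ} (hP : P.PosSemidef) :
    (rankOne v ^ 2 * P).trace.re ≤ B * (rankOne v * P).trace.re := by
  rw [rankOne_sq, Matrix.smul_mul, Matrix.trace_smul, smul_eq_mul, Complex.re_ofReal_mul]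
  exact mul_le_mul_of_nonneg_right hB ((rankOne_posSemidef v).trace_mul_re_nonneg hP)

/-- `⟨c, v v* c⟩ = |⟨v, c⟩|²`. -/
theorem trace_rankOne_mul_rankOne [Fintype ι] (c : ι → ℂ) :
    (rankOne v * rankOne c).trace.re = ‖∑ k, star (c k) * v k‖ ^ 2 := by
  rw [rankOne, rankOne, Matrix.vecMulVec_mul_vecMulVec, Matrix.trace_vecMulVec]
  have h1 : v ⬝ᵥ (star v ⬝ᵥ c) • star c = (∑ k, star (c k) * v k) *
      star (∑ k, star (c k) * v k) := by
    simp only [dotProduct, Pi.star_apply, Pi.smul_apply, smul_eq_mul, star_sum, star_mul', star_star,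
      Finset.sum_mul]
    refine Finset.sum_congr rfl fun k _ => ?_
    rw [Finset.mul_sum, Finset.mul_sum]
    refine Finset.sum_congr rfl fun l _ => ?_
    ring
  have h2 : (∑ k, star (c k) * v k) * star (∑ k, star (c k) * v k) =
      ((‖∑ k, star (c k) * v k‖ ^ 2 : ℝ) : ℂ) := by
    push_cast
    exact Complex.mul_conj' _
  rw [h1, h2, Complex.ofReal_re]

end RankOne

theorem sampleSum_rankOne_posSemidef {D ι : Type*} [Finite ι] {n : ℕ} (y : D → ι → ℂ) (X : Fin n → D) :
    (sampleSum (fun x => rankOne (y x)) X).PosSemidef :=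
  Matrix.posSemidef_sum _ fun _ _ => rankOne_posSemidef _

theorem integral_trace_eq_sum {D ι : Type*} [MeasurableSpace D] {ρ : Measure D}
    [IsProbabilityMeasure ρ] [Fintype ι] {n : ℕ} {M : (Fin n → D) → Matrix ι ι ℂ}
    (hM : MatrixMemLpTop M (Measure.pi fun _ => ρ)) :
    ∫ X, (M X).trace.re ∂(Measure.pi fun _ : Fin n => ρ) =
      ∑ k, ∫ X, (M X k k).re ∂(Measure.pi fun _ : Fin n => ρ) := by
  have hi : ∀ k, Integrable (fun X => (M X k k).re) (Measure.pi fun _ : Fin n => ρ) := fun k =>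
    ((hM k k).integrable le_top).re
  rw [← integral_finsetSum _ fun k _ => hi k]
  simp [Matrix.trace]

theorem sum_lam_mul_integral_le {D ι : Type*} [MeasurableSpace D] {ρ : Measure D}
    [IsProbabilityMeasure ρ] [Fintype ι] {lam : ι → ℝ} {n : ℕ} {V : ℝ}
    (hV : ∀ k, n * lam k ≤ V) {M : (Fin n → D) → Matrix ι ι ℂ}
    (hM : MatrixMemLpTop M (Measure.pi fun _ => ρ)) (hpsd : ∀ X, (M X).PosSemidef) :
    n * ∑ k, lam k * ∫ X, (M X k k).re ∂(Measure.pi fun _ : Fin n => ρ) ≤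
      V * ∫ X, (M X).trace.re ∂(Measure.pi fun _ : Fin n => ρ) := by
  rw [integral_trace_eq_sum hM, Finset.mul_sum, Finset.mul_sum]
  refine Finset.sum_le_sum fun k _ => ?_
  rw [← mul_assoc]
  refine mul_le_mul_of_nonneg_right (hV k) (integral_nonneg fun X => ?_)
  exact (Complex.nonneg_iff.1 (hpsd X).diag_nonneg).1

/-! ### Recursions for trace moments of the sample sum. -/

section Moments

variable {D ι : Type*} [MeasurableSpace D] [Fintype ι] [DecidableEq ι]

/-- Uniformly bounded vector-valued functions with uncorrelated components of second moments
`lam k`. -/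
structure IsBoundedSystem (ρ : Measure D) (y : D → ι → ℂ) (lam : ι → ℝ) (B : ℝ) : Prop where
  aestronglyMeasurable : ∀ k, AEStronglyMeasurable (fun x => y x k) ρ
  sum_le : ∀ x, ∑ k, ‖y x k‖ ^ 2 ≤ B
  integral_mul : ∀ k l, ∫ x, y x k * star (y x l) ∂ρ = if k = l then (lam k : ℂ) else 0

namespace IsBoundedSystem

variable {ρ : Measure D} {y : D → ι → ℂ} {lam : ι → ℝ} {B : ℝ}

theorem memLp (h : IsBoundedSystem ρ y lam B) (k : ι) : MemLp (fun x => y x k) ∞ ρ := by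
  refine memLp_top_of_bound (h.aestronglyMeasurable k) (√B) (Filter.Eventually.of_forall fun x => ?_)
  refine Real.le_sqrt_of_sq_le ((Finset.single_le_sum (f := fun k => ‖y x k‖ ^ 2)
    (fun k _ => by positivity) (Finset.mem_univ k)).trans (h.sum_le x))

theorem matrixMemLpTop (h : IsBoundedSystem ρ y lam B) :
    MatrixMemLpTop (fun x => rankOne (y x)) ρ :=
  fun k l => (h.memLp l).star.mul' (r := ∞) (h.memLp k)

theorem lam_eq (h : IsBoundedSystem ρ y lam B) (k : ι) : lam k = ∫ x, ‖y x k‖ ^ 2 ∂ρ := by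
  have h1 := h.integral_mul k k
  have h2 : ∀ x, y x k * star (y x k) = ((‖y x k‖ ^ 2 : ℝ) : ℂ) := fun x => by
    push_cast
    exact Complex.mul_conj' _
  simp only [h2, if_true] at h1
  have h3 : ∫ x, ((‖y x k‖ ^ 2 : ℝ) : ℂ) ∂ρ = ((∫ x, ‖y x k‖ ^ 2 ∂ρ : ℝ) : ℂ) := integral_ofReal
  exact_mod_cast h1.symm.trans h3

/-- Integrating the pointwise bound controls the trace of the mean independently of the dimension.
For an orthonormal system it bounds the dimension by `B`. -/
theorem sum_lam_le [IsProbabilityMeasure ρ] (h : IsBoundedSystem ρ y lam B) : ∑ k, lam k ≤ B := by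
  simp only [h.lam_eq]
  have hi : ∀ k, Integrable (fun x => ‖y x k‖ ^ 2) ρ := fun k =>
    ((h.memLp k).mono_exponent le_top).integrable_norm_pow two_ne_zero
  rw [← integral_finsetSum _ fun k _ => hi k]
  calc _ ≤ ∫ _, B ∂ρ := integral_mono (integrable_finsetSum _ fun k _ => hi k)
        (integrable_const _) h.sum_le
    _ = B := by simp

variable [IsProbabilityMeasure ρ]

theorem integral_trace_rankOne_mul (h : IsBoundedSystem ρ y lam B) {n : ℕ}
    {M : (Fin n → D) → Matrix ι ι ℂ} (hM : MatrixMemLpTop M (Measure.pi fun _ => ρ)) :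
    ∫ X, (rankOne (y (X 0)) * M (fun i => X i.succ)).trace.re
      ∂(Measure.pi fun _ : Fin (n + 1) => ρ) =
      ∑ k, lam k * ∫ X, (M X k k).re ∂(Measure.pi fun _ : Fin n => ρ) :=
  integral_trace_mul_succ_coords h.matrixMemLpTop h.integral_mul hM

theorem integral_trace_sampleSum (h : IsBoundedSystem ρ y lam B) (n : ℕ) :
    ∫ X, (sampleSum (fun x => rankOne (y x)) X).trace.re ∂(Measure.pi fun _ : Fin n => ρ) =
      n * ∑ k, lam k := by
  have hi : ∀ k, Integrable (fun x => ‖y x k‖ ^ 2) ρ := fun k =>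
    ((h.memLp k).mono_exponent le_top).integrable_norm_pow two_ne_zero
  have hi' : ∀ i : Fin n, Integrable (fun X : Fin n → D => ∑ k, ‖y (X i) k‖ ^ 2)
      (Measure.pi fun _ => ρ) := fun i =>
    (measurePreserving_eval (fun _ => ρ) i).integrable_comp_of_integrable
      (integrable_finsetSum _ fun k _ => hi k)
  simp only [sampleSum, Matrix.trace_sum, Complex.re_sum, trace_rankOne]
  rw [integral_finsetSum _ fun i _ => hi' i]
  have : ∀ i : Fin n, ∫ X : Fin n → D, ∑ k, ‖y (X i) k‖ ^ 2 ∂(Measure.pi fun _ => ρ) =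
      ∑ k, lam k := by
    intro i
    have hp := measurePreserving_eval (fun _ : Fin n => ρ) i
    have hs : Integrable (fun x => ∑ k, ‖y x k‖ ^ 2) ρ := integrable_finsetSum _ fun k _ => hi k
    calc _ = ∫ x, ∑ k, ‖y x k‖ ^ 2 ∂(Measure.map (Function.eval i)
          (Measure.pi fun _ : Fin n => ρ)) := by
          rw [integral_map hp.aemeasurable (by rw [hp.map_eq]; exact hs.1)]
      _ = _ := by
          rw [hp.map_eq, integral_finsetSum _ fun k _ => hi k]
          simp only [h.lam_eq]
  simp [this]

/-- Recursion for the trace moments of the sample sum. -/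
theorem integral_trace_pow_succ_succ_le (h : IsBoundedSystem ρ y lam B) {n : ℕ} {V : ℝ}
    (hV : ∀ k, n * lam k ≤ V) (q : ℕ) :
    ∫ X, (sampleSum (fun x => rankOne (y x)) X ^ (q + 2)).trace.re
        ∂(Measure.pi fun _ : Fin n => ρ) ≤
      V * ∫ X, (sampleSum (fun x => rankOne (y x)) X ^ (q + 1)).trace.re
        ∂(Measure.pi fun _ : Fin n => ρ) +
      (q + 1) * B * (∫ X, (sampleSum (fun x => rankOne (y x)) X ^ (q + 1)).trace.re
        ∂(Measure.pi fun _ : Fin n => ρ) +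
        n * ∑ k, lam k * ∫ X, ((sampleSum (fun x => rankOne (y x)) X ^ q) k k).re
          ∂(Measure.pi fun _ : Fin n => ρ)) := by
  set Z : D → Matrix ι ι ℂ := fun x => rankOne (y x) with hZ
  have hZm : MatrixMemLpTop Z ρ := h.matrixMemLpTop
  have hZi : ∀ i : Fin (n + 1), MatrixMemLpTop (fun X : Fin (n + 1) → D => Z (X i))
    (Measure.pi fun _ => ρ) := fun i => hZm.comp (measurePreserving_eval _ i)
  have hS := hZm.sampleSum (n := n)
  have hS' := hS.comp (measurePreserving_succ_coords ρ n)
  have hpsd : ∀ {m : ℕ} (X : Fin m → D), (sampleSum Z X).PosSemidef := sampleSum_rankOne_posSemidef y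
  have key := integral_trace_sampleSum_mul_pow_le (n := n) hZm
    (fun x => (rankOne_posSemidef (y x)).isHermitian) (C := 0) (q := q) (by simp)
    (Or.inr fun X => by rw [sub_zero]; exact hpsd X)
  simp only [sub_zero, ← pow_succ'] at key
  -- The mean of `Z` is diagonal with entries `lam k`, and `n * lam k ≤ V`.
  have h0 : n * ∫ X, (Z (X 0) * (sampleSum Z (fun j : Fin n => X j.succ)) ^ (q + 1)).trace.re
        ∂(Measure.pi fun _ : Fin (n + 1) => ρ) ≤
      V * ∫ X, (sampleSum Z X ^ (q + 1)).trace.re ∂(Measure.pi fun _ : Fin n => ρ) := by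
    rw [h.integral_trace_rankOne_mul (hS.pow (q + 1))]
    exact sum_lam_mul_integral_le hV (hS.pow _) fun X => (hpsd X).pow _
  -- Positivity of `(Z (X i.succ) + Z (X 0))²` gives `(Zᵢ - Z₀)² ≤ 2 Zᵢ² + 2 Z₀²` under the trace
  -- against `P`, and each square costs a factor `B`. The resulting 2 cancels the 1/2 from the
  -- exchange inequality.
  have h1 : ∀ i : Fin n, ∫ X, ((Z (X i.succ) - Z (X 0)) ^ 2 *
        (sampleSum Z (fun j : Fin n => X j.succ)) ^ q).trace.re
        ∂(Measure.pi fun _ : Fin (n + 1) => ρ) ≤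
      2 * B * (∫ X, (Z (X i.succ) * (sampleSum Z (fun j : Fin n => X j.succ)) ^ q).trace.re
        ∂(Measure.pi fun _ : Fin (n + 1) => ρ) +
        ∑ k, lam k * ∫ X, ((sampleSum Z X ^ q) k k).re ∂(Measure.pi fun _ : Fin n => ρ)) := by
    intro i
    rw [← h.integral_trace_rankOne_mul (hS.pow q), ← integral_add
      ((hZi _).mul (hS'.pow _)).integrable_trace_re ((hZi _).mul (hS'.pow _)).integrable_trace_re,
      ← integral_const_mul]
    refine integral_mono ((((hZi _).sub (hZi _)).pow 2).mul (hS'.pow _)).integrable_trace_re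
      ((((hZi _).mul (hS'.pow _)).integrable_trace_re.add
        ((hZi _).mul (hS'.pow _)).integrable_trace_re).const_mul _) fun X => ?_
    set P := (sampleSum Z (fun j : Fin n => X j.succ)) ^ q with hP
    have hPp : P.PosSemidef := (hpsd _).pow _
    have e1 := trace_rankOne_sq_mul_le (y (X i.succ)) (h.sum_le _) hPp
    have e2 := trace_rankOne_sq_mul_le (y (X 0)) (h.sum_le _) hPp
    have e3 : 0 ≤ ((Z (X i.succ) + Z (X 0)) ^ 2 * P).trace.re :=
      (((rankOne_posSemidef _).add (rankOne_posSemidef _)).pow 2).trace_mul_re_nonneg hPp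
    have e4 : (Z (X i.succ) - Z (X 0)) ^ 2 * P =
        Z (X i.succ) ^ 2 * P + Z (X i.succ) ^ 2 * P + Z (X 0) ^ 2 * P + Z (X 0) ^ 2 * P -
          (Z (X i.succ) + Z (X 0)) ^ 2 * P := by
      noncomm_ring
    simp only [e4, Matrix.trace_add, Matrix.trace_sub, Complex.add_re, Complex.sub_re]
    simp only [hZ] at e3 ⊢
    linarith
  have h2 := Finset.sum_le_sum fun i (_ : i ∈ Finset.univ) => h1 i
  rw [← Finset.mul_sum, Finset.sum_add_distrib,
    ← integral_finsetSum _ fun i _ => ((hZi _).mul (hS'.pow _)).integrable_trace_re] at h2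
  have h3 : ∫ X, ∑ i : Fin n, (Z (X i.succ) *
      (sampleSum Z (fun j : Fin n => X j.succ)) ^ q).trace.re
        ∂(Measure.pi fun _ : Fin (n + 1) => ρ) =
      ∫ X, (sampleSum Z X ^ (q + 1)).trace.re ∂(Measure.pi fun _ : Fin n => ρ) := by
    rw [← integral_succ_coords (hS.pow (q + 1)).integrable_trace_re]
    congr 1
    ext X
    rw [← Complex.re_sum, ← Matrix.trace_sum, ← Finset.sum_mul, pow_succ']
    rfl
  rw [h3] at h2
  simp only [Finset.sum_const, Finset.card_univ, Fintype.card_fin, nsmul_eq_mul] at h2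
  have h4 := mul_le_mul_of_nonneg_left h2 (by positivity : (0 : ℝ) ≤ (q + 1) / 2)
  linarith

theorem integral_trace_pow_succ_le (h : IsBoundedSystem ρ y lam B) {n : ℕ} {V L : ℝ}
    (hV0 : 0 ≤ V) (hV : ∀ k, n * lam k ≤ V) (hB : 0 ≤ B) (hL : 2 ≤ L) (hBL : B * L ≤ V) (q : ℕ)
    (hq : (q : ℝ) ≤ L) :
    ∫ X, (sampleSum (fun x => rankOne (y x)) X ^ (q + 1)).trace.re
        ∂(Measure.pi fun _ : Fin n => ρ) ≤ n * B * (5 / 2 * V) ^ q := by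
  set M : ℕ → ℝ := fun p => ∫ X, (sampleSum (fun x => rankOne (y x)) X ^ p).trace.re
        ∂(Measure.pi fun _ : Fin n => ρ) with hM
  have hMn : ∀ p, 0 ≤ M p := fun p => integral_nonneg fun X => by
    have := ((sampleSum_rankOne_posSemidef y X).pow p).trace_mul_re_nonneg Matrix.PosSemidef.one
    simpa using this
  have hS := h.matrixMemLpTop.sampleSum (n := n)
  have hM1 : M 1 = n * ∑ k, lam k := by
    simp only [hM, pow_one]
    exact h.integral_trace_sampleSum n
  have hM1' : M 1 ≤ n * B := by
    rw [hM1]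
    exact mul_le_mul_of_nonneg_left h.sum_lam_le (by positivity)
  suffices H : ∀ q : ℕ, (q : ℝ) ≤ L → M (q + 1) ≤ M 1 * (5 / 2 * V) ^ q from
    (H q hq).trans (mul_le_mul_of_nonneg_right hM1' (by positivity))
  intro q
  induction q using Nat.twoStepInduction with
  | zero => intro _; simp
  | one =>
    intro _
    have h1 := h.integral_trace_pow_succ_succ_le hV 0
    -- At order zero the last term of the recursion is exactly the first moment. Bounding it by `V`
    -- times `tr 1` would bring in the dimension.
    have h2 : n * ∑ k, lam k * ∫ X, ((sampleSum (fun x => rankOne (y x)) X ^ 0) k k).re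
          ∂(Measure.pi fun _ : Fin n => ρ) = M 1 := by
      rw [hM1]
      simp
    rw [h2] at h1
    change M 2 ≤ V * M 1 + (((0 : ℕ) : ℝ) + 1) * B * (M 1 + M 1) at h1
    have h3 : 2 * B ≤ V := by nlinarith
    have h4 := mul_le_mul_of_nonneg_right h3 (hMn 1)
    have h5 := mul_nonneg hV0 (hMn 1)
    change M 2 ≤ _
    push_cast at h1
    rw [pow_one]
    linarith
  | more q ih1 ih2 =>
    intro hq
    push_cast at hq ih2
    have i1 := ih1 (by linarith)
    have i2 := ih2 (by linarith)
    have h1 := h.integral_trace_pow_succ_succ_le hV (q + 1)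
    have h2 := sum_lam_mul_integral_le hV (hS.pow (q + 1))
      fun X => (sampleSum_rankOne_posSemidef y X).pow _
    change M (q + 3) ≤ V * M (q + 2) + (((q + 1 : ℕ) : ℝ) + 1) * B * (M (q + 2) + _) at h1
    change _ ≤ V * M (q + 1) at h2
    have h3 : (((q + 1 : ℕ) : ℝ) + 1) * B ≤ V := by
      push_cast
      calc ((q : ℝ) + 1 + 1) * B ≤ L * B := by
            apply mul_le_mul_of_nonneg_right _ hB
            linarith
        _ ≤ V := by linarith
    have h4 : (((q + 1 : ℕ) : ℝ) + 1) * B * (M (q + 2) + (n * ∑ k, lam k *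
        ∫ X, ((sampleSum (fun x => rankOne (y x)) X ^ (q + 1)) k k).re
          ∂(Measure.pi fun _ : Fin n => ρ))) ≤ V * (M (q + 2) + V * M (q + 1)) := by
      refine (mul_le_mul_of_nonneg_left (add_le_add_right h2 _) (by positivity)).trans ?_
      exact mul_le_mul_of_nonneg_right h3
        (add_nonneg (hMn _) (mul_nonneg hV0 (hMn _)))
    change M (q + 3) ≤ _
    have h5 := mul_le_mul_of_nonneg_left i1 (mul_nonneg hV0 hV0)
    have h6 := mul_le_mul_of_nonneg_left i2 hV0
    have h7 : 0 ≤ M 1 * (5 / 2 * V) ^ q * V ^ 2 := mul_nonneg (mul_nonneg (hMn 1) (by positivity))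
      (by positivity)
    change V * M (q + 2) ≤ _ at h6
    -- The recursion is now `M (q+3) ≤ 2 V M (q+2) + V² M (q+1)`. The rate 5/2 is admissible since
    -- `2 · (5/2) + 1 ≤ (5/2)²`.
    calc M (q + 3) ≤ 2 * (V * (M 1 * (5 / 2 * V) ^ (q + 1))) +
          V * V * (M 1 * (5 / 2 * V) ^ q) := by linarith
      _ ≤ M 1 * (5 / 2 * V) ^ (q + 2) := by
        rw [pow_succ, pow_add]
        linarith

/-- Recursion for the even trace moments of the deviation of the sample sum from its mean. -/
theorem integral_trace_dev_pow_le (h : IsBoundedSystem ρ y (fun _ => 1) B) (hB : 0 ≤ B) {n : ℕ}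
    (hn : 0 < n) (p : ℕ) (hp : 28 * ((p : ℝ) + 1) * B ≤ n) :
    ∫ X, ((sampleSum (fun x => rankOne (y x)) X - (n : ℂ) • (1 : Matrix ι ι ℂ)) ^
        (2 * p + 2)).trace.re ∂(Measure.pi fun _ : Fin n => ρ) ≤
      (n : ℝ) ^ 2 / 11 *
        ∫ X, ((sampleSum (fun x => rankOne (y x)) X - (n : ℂ) • (1 : Matrix ι ι ℂ)) ^
        (2 * p)).trace.re ∂(Measure.pi fun _ : Fin n => ρ) := by
  set Z : D → Matrix ι ι ℂ := fun x => rankOne (y x) with hZ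
  set C : Matrix ι ι ℂ := (n : ℂ) • (1 : Matrix ι ι ℂ) with hC
  have hCh : C.IsHermitian := by
    rw [Matrix.IsHermitian, hC, Matrix.conjTranspose_smul]
    simp
  have hn' : (0 : ℝ) < n := by exact_mod_cast hn
  have hZm : MatrixMemLpTop Z ρ := h.matrixMemLpTop
  have hZi : ∀ i : Fin (n + 1), MatrixMemLpTop (fun X : Fin (n + 1) → D => Z (X i))
    (Measure.pi fun _ => ρ) := fun i => hZm.comp (measurePreserving_eval _ i)
  have hS := hZm.sampleSum (n := n)
  have hΔ := hS.sub (.const C)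
  have hΔ' := hΔ.comp (measurePreserving_succ_coords ρ n)
  have hpsd : ∀ X : Fin n → D, (sampleSum Z X).PosSemidef := sampleSum_rankOne_posSemidef y
  have hherm : ∀ X : Fin n → D, (sampleSum Z X - C).IsHermitian := fun X =>
    (hpsd X).isHermitian.sub hCh
  set W : ℕ → ℝ := fun p => ∫ X, ((sampleSum Z X - C) ^ p).trace.re
    ∂(Measure.pi fun _ : Fin n => ρ) with hW
  have key := integral_trace_sampleSum_mul_pow_le (n := n) hZm
    (fun x => (rankOne_posSemidef (y x)).isHermitian) hCh (q := 2 * p) (Or.inl (by simp))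
  have hSΔ : ∀ r : ℕ, ∫ X, (sampleSum Z X * (sampleSum Z X - C) ^ r).trace.re
      ∂(Measure.pi fun _ : Fin n => ρ) = W (r + 1) + n * W r := by
    intro r
    simp only [hW]
    rw [← integral_const_mul, ← integral_add (hΔ.pow _).integrable_trace_re
      ((hΔ.pow _).integrable_trace_re.const_mul _)]
    congr 1
    ext X
    have : sampleSum Z X * (sampleSum Z X - C) ^ r =
        (sampleSum Z X - C) ^ (r + 1) + (n : ℂ) • (sampleSum Z X - C) ^ r := by
      rw [pow_succ', sub_mul (sampleSum Z X) C, hC, Matrix.smul_mul, Matrix.one_mul]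
      abel
    rw [this, Matrix.trace_add, Matrix.trace_smul, smul_eq_mul, Complex.add_re,
      ← Complex.ofReal_natCast, Complex.re_ofReal_mul]
  -- Here the mean of `Z` is the identity, so an independent factor `Z (X 0)` simply drops out.
  have hcov : ∀ {M : (Fin n → D) → Matrix ι ι ℂ}, MatrixMemLpTop M (Measure.pi fun _ => ρ) →
      ∫ X, (Z (X 0) * M (fun i => X i.succ)).trace.re ∂(Measure.pi fun _ : Fin (n + 1) => ρ) =
      ∫ X, (M X).trace.re ∂(Measure.pi fun _ : Fin n => ρ) := by
    intro M hM
    rw [h.integral_trace_rankOne_mul hM, integral_trace_eq_sum hM]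
    simp
  rw [hSΔ, hcov (hΔ.pow (2 * p + 1))] at key
  have h1 : ∀ i : Fin n, ∫ X, ((Z (X i.succ) - Z (X 0)) ^ 2 *
        (sampleSum Z (fun j : Fin n => X j.succ) - C) ^ (2 * p)).trace.re
        ∂(Measure.pi fun _ : Fin (n + 1) => ρ) ≤
      B * (∫ X, (Z (X i.succ) * (sampleSum Z (fun j : Fin n => X j.succ) - C) ^ (2 * p)).trace.re
        ∂(Measure.pi fun _ : Fin (n + 1) => ρ) + W (2 * p)) := by
    intro i
    have hPm := hΔ.pow (2 * p)
    have hPm' := hΔ'.pow (2 * p)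
    have hzi : MatrixMemLpTop (fun X : Fin n → D => Z (X i)) (Measure.pi fun _ => ρ) :=
      hZm.comp (measurePreserving_eval _ i)
    have hpos : ∀ X : Fin n → D, 0 ≤ (Z (X i) * (sampleSum Z X - C) ^ (2 * p)).trace.re := fun X =>
      (rankOne_posSemidef _).trace_mul_re_nonneg ((hherm X).posSemidef_pow_of_even (by simp))
    -- Because the mean is the identity, the cross terms of `(Zᵢ - Z₀)²` have nonnegative
    -- expectation. They can be discarded, which saves the factor 2 that the general recursion pays.
    have c1 : 0 ≤ ∫ X, (Z (X 0) * (Z (X i.succ) *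
        (sampleSum Z (fun j : Fin n => X j.succ) - C) ^ (2 * p))).trace.re
        ∂(Measure.pi fun _ : Fin (n + 1) => ρ) := by
      rw [hcov (hzi.mul hPm)]
      exact integral_nonneg hpos
    have c2 : 0 ≤ ∫ X, (Z (X 0) * ((sampleSum Z (fun j : Fin n => X j.succ) - C) ^ (2 * p) *
        Z (X i.succ))).trace.re
        ∂(Measure.pi fun _ : Fin (n + 1) => ρ) := by
      rw [hcov (hPm.mul hzi)]
      refine integral_nonneg fun X => ?_
      simp only [Pi.zero_apply]
      rw [Matrix.trace_mul_comm]
      exact hpos X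
    have i1 := ((hZi 0).mul ((hZi i.succ).mul hPm')).integrable_trace_re
    have i2 := ((hZi 0).mul (hPm'.mul (hZi i.succ))).integrable_trace_re
    have i3 := ((hZi i.succ).mul hPm').integrable_trace_re
    have i4 := ((hZi 0).mul hPm').integrable_trace_re
    have i5 := ((((hZi i.succ).sub (hZi 0)).pow 2).mul hPm').integrable_trace_re
    have hW2 : W (2 * p) = _ := (hcov hPm).symm
    rw [hW2, ← integral_add i3 i4, ← integral_const_mul]
    have hpt : ∀ X : Fin (n + 1) → D, ((Z (X i.succ) - Z (X 0)) ^ 2 *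
        (sampleSum Z (fun j : Fin n => X j.succ) - C) ^ (2 * p)).trace.re +
        (Z (X 0) * (Z (X i.succ) *
          (sampleSum Z (fun j : Fin n => X j.succ) - C) ^ (2 * p))).trace.re +
        (Z (X 0) * ((sampleSum Z (fun j : Fin n => X j.succ) - C) ^ (2 * p) *
          Z (X i.succ))).trace.re ≤
        B * ((Z (X i.succ) * (sampleSum Z (fun j : Fin n => X j.succ) - C) ^ (2 * p)).trace.re +
          (Z (X 0) * (sampleSum Z (fun j : Fin n => X j.succ) - C) ^ (2 * p)).trace.re) := by
      intro X
      have hPp : ((sampleSum Z (fun j : Fin n => X j.succ) - C) ^ (2 * p)).PosSemidef :=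
        (hherm _).posSemidef_pow_of_even (by simp)
      generalize (sampleSum Z (fun j : Fin n => X j.succ) - C) ^ (2 * p) = P at hPp
      have e1 : (Z (X i.succ) ^ 2 * P).trace.re ≤ B * (Z (X i.succ) * P).trace.re :=
        trace_rankOne_sq_mul_le (y (X i.succ)) (h.sum_le _) hPp
      have e2 : (Z (X 0) ^ 2 * P).trace.re ≤ B * (Z (X 0) * P).trace.re :=
        trace_rankOne_sq_mul_le (y (X 0)) (h.sum_le _) hPp
      have e4 : (Z (X i.succ) - Z (X 0)) ^ 2 * P =
          Z (X i.succ) ^ 2 * P + Z (X 0) ^ 2 * P - Z (X i.succ) * (Z (X 0) * P) -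
            Z (X 0) * (Z (X i.succ) * P) := by
        noncomm_ring
      have e5 : (Z (X i.succ) * (Z (X 0) * P)).trace = (Z (X 0) * (P * Z (X i.succ))).trace := by
        rw [Matrix.trace_mul_comm, Matrix.mul_assoc]
      simp only [e4, Matrix.trace_add, Matrix.trace_sub, Complex.add_re, Complex.sub_re, e5]
      linarith
    have i51 : Integrable (fun X : Fin (n + 1) → D => ((Z (X i.succ) - Z (X 0)) ^ 2 *
        (sampleSum Z (fun j : Fin n => X j.succ) - C) ^ (2 * p)).trace.re +
        (Z (X 0) * (Z (X i.succ) *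
          (sampleSum Z (fun j : Fin n => X j.succ) - C) ^ (2 * p))).trace.re)
        (Measure.pi fun _ => ρ) := i5.add i1
    have := integral_mono (i51.add i2) ((i3.add i4).const_mul B) hpt
    simp only [Pi.add_apply] at this
    rw [integral_add i51 i2, integral_add i5 i1] at this
    linarith
  have h2 := Finset.sum_le_sum fun i (_ : i ∈ Finset.univ) => h1 i
  rw [← Finset.mul_sum, Finset.sum_add_distrib, ← integral_finsetSum _ fun i _ =>
    ((hZi _).mul (hΔ'.pow _)).integrable_trace_re] at h2
  have h3 : ∫ X, ∑ i : Fin n, (Z (X i.succ) *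
      (sampleSum Z (fun j : Fin n => X j.succ) - C) ^ (2 * p)).trace.re
        ∂(Measure.pi fun _ : Fin (n + 1) => ρ) = W (2 * p + 1) + n * W (2 * p) := by
    rw [← hSΔ, ← integral_succ_coords (hS.mul (hΔ.pow (2 * p))).integrable_trace_re]
    congr 1
    ext X
    rw [← Complex.re_sum, ← Matrix.trace_sum, ← Finset.sum_mul]
    rfl
  rw [h3] at h2
  simp only [Finset.sum_const, Finset.card_univ, Fintype.card_fin, nsmul_eq_mul] at h2
  -- The odd moment is eliminated by positivity of `tr ((Δ - n)² Δ^(2p))`.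
  have h5 : 2 * n * W (2 * p + 1) ≤ W (2 * p + 2) + n ^ 2 * W (2 * p) := by
    simp only [hW]
    rw [← integral_const_mul, ← integral_const_mul, ← integral_add (hΔ.pow _).integrable_trace_re
      ((hΔ.pow _).integrable_trace_re.const_mul _)]
    refine integral_mono ((hΔ.pow _).integrable_trace_re.const_mul _)
      ((hΔ.pow _).integrable_trace_re.add ((hΔ.pow _).integrable_trace_re.const_mul _)) fun X => ?_
    set Δ := sampleSum Z X - C with hΔdef
    have e1 : 0 ≤ ((Δ - C) ^ 2 * Δ ^ (2 * p)).trace.re :=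
      (((hherm X).sub hCh).posSemidef_pow_of_even even_two).trace_mul_re_nonneg
        ((hherm X).posSemidef_pow_of_even (by simp))
    have e2 : (Δ - C) ^ 2 * Δ ^ (2 * p) =
        Δ ^ (2 * p + 2) - (n : ℂ) • Δ ^ (2 * p + 1) - (n : ℂ) • Δ ^ (2 * p + 1) +
        (n : ℂ) • (n : ℂ) • Δ ^ (2 * p) := by
      rw [show 2 * p + 2 = (2 * p + 1) + 1 from rfl, pow_succ' Δ (2 * p + 1), pow_succ' Δ (2 * p),
        hC]
      simp only [pow_two, sub_mul, mul_sub, Matrix.smul_mul, Matrix.mul_smul, Matrix.one_mul,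
        Matrix.mul_one, Matrix.mul_assoc]
      abel
    rw [e2] at e1
    simp only [Matrix.trace_add, Matrix.trace_sub, Complex.add_re, Complex.sub_re,
      Matrix.trace_smul, smul_eq_mul, ← Complex.ofReal_natCast, Complex.re_ofReal_mul] at e1
    simp only
    linarith
  have hWn : ∀ r, Even r → 0 ≤ W r := fun r hr => integral_nonneg fun X => by
    have := ((hherm X).posSemidef_pow_of_even hr).trace_mul_re_nonneg Matrix.PosSemidef.one
    simpa using this
  have hW1 := hWn (2 * p) (by simp)
  have hW2 := hWn (2 * p + 2) (by simp [Nat.even_add])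
  have h4 := mul_le_mul_of_nonneg_left h2 (by positivity : (0 : ℝ) ≤ ((2 * p : ℕ) + 1) / 2)
  change W (2 * p + 2) ≤ (n : ℝ) ^ 2 / 11 * W (2 * p)
  change W (2 * p + 2) + n * W (2 * p + 1) ≤ n * W (2 * p + 1) + _ at key
  set a := ((2 * p : ℕ) + 1 : ℝ) / 2 * B with ha
  have ha0 : 0 ≤ a := by positivity
  have ha1 : 28 * a ≤ n := by
    rw [ha]
    push_cast
    linarith
  have h6 : W (2 * p + 2) ≤ a * (W (2 * p + 1) + 2 * n * W (2 * p)) := by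
    rw [ha]
    linarith
  have h7 : 2 * n * W (2 * p + 2) ≤ a * (W (2 * p + 2) + 5 * n ^ 2 * W (2 * p)) := by
    have := mul_le_mul_of_nonneg_left h5 ha0
    have := mul_le_mul_of_nonneg_left h6 (by positivity : (0 : ℝ) ≤ 2 * n)
    linarith
  have h8 : 28 * a * (W (2 * p + 2) + 5 * n ^ 2 * W (2 * p)) ≤
      n * (W (2 * p + 2) + 5 * n ^ 2 * W (2 * p)) :=
    mul_le_mul_of_nonneg_right ha1 (by positivity)
  -- With `28 a ≤ n`, doubling the previous bound gives `56 W (2p+2) ≤ W (2p+2) + 5 n² W (2p)`,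
  -- whence the ratio `n² / 11`.
  have h9 : n * (55 * W (2 * p + 2)) ≤ n * (5 * n ^ 2 * W (2 * p)) := by linarith
  have := le_of_mul_le_mul_left h9 hn'
  linarith

theorem integral_trace_dev_pow_le_card (h : IsBoundedSystem ρ y (fun _ => 1) B) (hB : 0 ≤ B)
    {n : ℕ} (hn : 0 < n) (p : ℕ) (hp : 28 * (p : ℝ) * B ≤ n) :
    ∫ X, ((sampleSum (fun x => rankOne (y x)) X - (n : ℂ) • (1 : Matrix ι ι ℂ)) ^
        (2 * p)).trace.re ∂(Measure.pi fun _ : Fin n => ρ) ≤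
      Fintype.card ι * ((n : ℝ) ^ 2 / 11) ^ p := by
  induction p with
  | zero => simp
  | succ p ih =>
    push_cast at hp
    have h1 := h.integral_trace_dev_pow_le hB hn p hp
    have h2 := ih (by nlinarith)
    rw [pow_succ]
    calc _ ≤ _ := h1
      _ ≤ (n : ℝ) ^ 2 / 11 * (Fintype.card ι * ((n : ℝ) ^ 2 / 11) ^ p) := by gcongr
      _ = _ := by ring

end IsBoundedSystem
end Moments
-- Tail bounds from Markov's inequality.
namespace IsBoundedSystem

variable {D ι : Type*} [MeasurableSpace D] [Fintype ι] [DecidableEq ι]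
  {ρ : Measure D} [IsProbabilityMeasure ρ] {y : D → ι → ℂ} {lam : ι → ℝ} {B : ℝ}

theorem _root_.trace_sampleSum_mul_rankOne {D ι : Type*} [Fintype ι] (y : D → ι → ℂ) {n : ℕ}
    (X : Fin n → D) (c : ι → ℂ) :
    (sampleSum (fun x => rankOne (y x)) X * rankOne c).trace.re =
      ∑ i, ‖∑ k, star (c k) * y (X i) k‖ ^ 2 := by
  simp only [sampleSum, Finset.sum_mul, Matrix.trace_sum, Complex.re_sum,
    trace_rankOne_mul_rankOne]

/-- Upper tail bound for the largest eigenvalue of the sample sum. -/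
theorem measureReal_upper_tail_le (h : IsBoundedSystem ρ y lam B) (hB : 0 ≤ B) {n : ℕ}
    (hn : 1 ≤ n) {V : ℝ} (hV0 : 0 < V) (hV : ∀ k, n * lam k ≤ V)
    (hBV : B * Real.log (8 * n) ≤ V) {δ : ℝ} (hδ₀ : 0 < δ) (hδ₁ : δ < 1) :
    (Measure.pi fun _ : Fin n => ρ).real {X | ¬ ∀ c : ι → ℂ,
      ∑ i, ‖∑ k, star (c k) * y (X i) k‖ ^ 2 ≤ 10 * V / δ * ∑ k, ‖c k‖ ^ 2} ≤ δ := by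
  have hn' : (1 : ℝ) ≤ n := by exact_mod_cast hn
  set L := Real.log (8 * n) with hL
  have hL2 : 2 ≤ L := by
    rw [hL, show (2 : ℝ) = Real.log (Real.exp 2) by simp]
    refine Real.log_le_log (Real.exp_pos _) ?_
    have : Real.exp 2 = Real.exp 1 ^ 2 := by rw [← Real.exp_nat_mul]; norm_num
    rw [this]
    nlinarith [Real.exp_one_lt_d9, Real.exp_pos 1]
  -- The order must satisfy `q ≤ L` for the moment bound and `q + 1 > L`, so that `e^(q+1)` exceeds
  -- `8 n`.
  set q := ⌊L⌋₊ with hq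
  have hq1 : (q : ℝ) ≤ L := Nat.floor_le (by linarith)
  have hq2 : L < q + 1 := Nat.lt_floor_add_one L
  have hM := h.integral_trace_pow_succ_le (n := n) hV0.le hV hB hL2 hBV q hq1
  have hS := h.matrixMemLpTop.sampleSum (n := n)
  set t := 10 * V / δ with ht
  have ht0 : 0 < t := by positivity
  have hmarkov := mul_meas_ge_le_integral_of_nonneg
    (μ := Measure.pi fun _ : Fin n => ρ)
    (f := fun X => (sampleSum (fun x => rankOne (y x)) X ^ (q + 1)).trace.re)
    (Filter.Eventually.of_forall fun X => by
      have := ((sampleSum_rankOne_posSemidef y X).pow (q + 1)).trace_mul_re_nonneg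
        Matrix.PosSemidef.one
      simpa using this) (hS.pow _).integrable_trace_re (t ^ (q + 1))
  have hsub : {X : Fin n → D | ¬ ∀ c : ι → ℂ,
      ∑ i, ‖∑ k, star (c k) * y (X i) k‖ ^ 2 ≤ t * ∑ k, ‖c k‖ ^ 2} ⊆
      {X | t ^ (q + 1) ≤ (sampleSum (fun x => rankOne (y x)) X ^ (q + 1)).trace.re} := by
    intro X hX
    by_contra hlt
    simp only [Set.mem_ofPred_eq, not_le] at hlt
    refine hX fun c => ?_
    have hp := sampleSum_rankOne_posSemidef y X
    have := hp.isHermitian.abs_trace_mul_le_of_trace_pow_lt (rankOne_posSemidef c) ht0.le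
      (Or.inr hp) hlt
    rw [trace_sampleSum_mul_rankOne, trace_rankOne] at this
    exact (le_abs_self _).trans this
  refine (measureReal_mono hsub).trans ?_
  have h1 := hmarkov.trans hM
  rw [← le_div_iff₀' (by positivity)] at h1
  refine h1.trans ?_
  rw [div_le_iff₀ (by positivity), ht, div_pow, mul_div_assoc', le_div_iff₀ (by positivity)]
  have h8 : (8 * n : ℝ) ≤ 4 ^ (q + 1) := by
    calc (8 * n : ℝ) = Real.exp L := (Real.exp_log (by positivity)).symm
      _ ≤ Real.exp ((q + 1 : ℕ) * 1) := Real.exp_le_exp.2 (by push_cast; linarith)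
      _ = Real.exp 1 ^ (q + 1) := Real.exp_nat_mul _ _
      _ ≤ 4 ^ (q + 1) := pow_le_pow_left₀ (Real.exp_pos 1).le
          (by linarith [Real.exp_one_lt_d9]) _
  have hδq : δ ^ (q + 1) ≤ δ := by
    rw [pow_succ]
    exact mul_le_of_le_one_left hδ₀.le (pow_le_one₀ hδ₀.le hδ₁.le)
  have hB' : B ≤ V := by nlinarith
  -- The constant 10 is `4 · (5/2)`: the moments grow at rate `5/2 · V`, and the spare `4^q ≥ 2 n`
  -- absorbs the prefactor `n`.
  have e1 : (10 * V) ^ (q + 1) = 10 * V * (4 ^ q * (5 / 2 * V) ^ q) := by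
    rw [← mul_pow, pow_succ]
    ring
  have h9 : n * B ≤ 10 * V * 4 ^ q := by
    have h10 : (2 * n : ℝ) ≤ 4 ^ q := by rw [pow_succ] at h8; linarith
    nlinarith
  calc n * B * (5 / 2 * V) ^ q * δ ^ (q + 1) ≤ n * B * (5 / 2 * V) ^ q * δ := by gcongr
    _ ≤ 10 * V * 4 ^ q * (5 / 2 * V) ^ q * δ := by gcongr
    _ = _ := by rw [e1]; ring

/-- Lower tail bound for the smallest eigenvalue of the sample sum. -/
theorem measureReal_lower_tail_le (h : IsBoundedSystem ρ y (fun _ => 1) B) (hB : 0 ≤ B) {n : ℕ}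
    (hn : 1 ≤ n) {δ : ℝ} (hδ₀ : 0 < δ) (hδ₁ : δ < 1)
    (hBn : B ≤ n / (48 * (√2 * Real.log (2 * n) - Real.log δ))) :
    (Measure.pi fun _ : Fin n => ρ).real {X | ¬ ∀ c : ι → ℂ,
      (n : ℝ) / 2 * ∑ k, ‖c k‖ ^ 2 ≤ ∑ i, ‖∑ k, star (c k) * y (X i) k‖ ^ 2} ≤ 2 * δ := by
  have hn' : (1 : ℝ) ≤ n := by exact_mod_cast hn
  have hcard : (Fintype.card ι : ℝ) ≤ B := by simpa using h.sum_lam_le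
  rcases isEmpty_or_nonempty ι with hι | hι
  · have : {X : Fin n → D | ¬ ∀ c : ι → ℂ, (n : ℝ) / 2 * ∑ k, ‖c k‖ ^ 2 ≤
      ∑ i, ‖∑ k, star (c k) * y (X i) k‖ ^ 2} = ∅ := by
      ext X
      simp
    rw [this]
    simpa using hδ₀.le
  have hB1 : 1 ≤ B := by
    refine le_trans ?_ hcard
    exact_mod_cast Fintype.card_pos
  have hlog2 : Real.log 2 ≤ Real.log (2 * n) := Real.log_le_log (by norm_num) (by linarith)
  have hl2 := Real.log_two_gt_d9
  have hlδ : Real.log δ < 0 := Real.log_neg hδ₀ hδ₁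
  have hsq : 1 ≤ √2 := Real.one_le_sqrt.2 (by norm_num)
  -- Chosen so that `e^A = 2 n / δ`. The factor `√2` in the hypothesis is only slack.
  set A := Real.log (2 * n) - Real.log δ with hA
  have hA0 : 0.69 < A := by rw [hA]; norm_num at hl2 ⊢; linarith
  have hA1 : A ≤ √2 * Real.log (2 * n) - Real.log δ := by rw [hA]; nlinarith
  have hBn' : B ≤ n / (48 * A) := hBn.trans (by gcongr)
  rw [le_div_iff₀ (by positivity)] at hBn'
  have hdn : (Fintype.card ι : ℝ) ≤ n := by nlinarith
  set p := ⌊A⌋₊ with hp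
  have hp1 : (p : ℝ) ≤ A := Nat.floor_le (by linarith)
  have hp2 : A < p + 1 := Nat.lt_floor_add_one A
  have hM := h.integral_trace_dev_pow_le_card hB hn p (by
    have := mul_le_mul_of_nonneg_right hp1 hB
    nlinarith)
  set C : Matrix ι ι ℂ := (n : ℂ) • (1 : Matrix ι ι ℂ) with hC
  have hCh : C.IsHermitian := by
    rw [Matrix.IsHermitian, hC, Matrix.conjTranspose_smul]
    simp
  have hherm : ∀ X : Fin n → D, (sampleSum (fun x => rankOne (y x)) X - C).IsHermitian := fun X =>
    (sampleSum_rankOne_posSemidef y X).isHermitian.sub hCh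
  have hS := (h.matrixMemLpTop.sampleSum (n := n)).sub (.const C)
  have hmarkov := mul_meas_ge_le_integral_of_nonneg
    (μ := Measure.pi fun _ : Fin n => ρ)
    (f := fun X => ((sampleSum (fun x => rankOne (y x)) X - C) ^ (2 * p)).trace.re)
    (Filter.Eventually.of_forall fun X => by
      have := ((hherm X).posSemidef_pow_of_even (even_two_mul p)).trace_mul_re_nonneg
        Matrix.PosSemidef.one
      simpa using this) (hS.pow _).integrable_trace_re (((n : ℝ) / 2) ^ (2 * p))
  have hsub : {X : Fin n → D | ¬ ∀ c : ι → ℂ,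
      (n : ℝ) / 2 * ∑ k, ‖c k‖ ^ 2 ≤ ∑ i, ‖∑ k, star (c k) * y (X i) k‖ ^ 2} ⊆
      {X | ((n : ℝ) / 2) ^ (2 * p) ≤
        ((sampleSum (fun x => rankOne (y x)) X - C) ^ (2 * p)).trace.re} := by
    intro X hX
    by_contra hlt
    simp only [Set.mem_ofPred_eq, not_le] at hlt
    refine hX fun c => ?_
    have := (hherm X).abs_trace_mul_le_of_trace_pow_lt (rankOne_posSemidef c) (by positivity)
      (Or.inl (even_two_mul p)) hlt
    rw [sub_mul, Matrix.trace_sub, Complex.sub_re, trace_sampleSum_mul_rankOne, hC,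
      Matrix.smul_mul, Matrix.one_mul, Matrix.trace_smul, smul_eq_mul, ← Complex.ofReal_natCast,
      Complex.re_ofReal_mul, trace_rankOne] at this
    have := (abs_le.1 this).1
    linarith
  refine (measureReal_mono hsub).trans ?_
  have h1 := hmarkov.trans hM
  rw [← le_div_iff₀' (by positivity)] at h1
  refine h1.trans ?_
  -- The threshold `n² / 4` exceeds the moment rate `n² / 11` by the factor `11 / 4 > e`. Thus `p +
  -- 1 > A` yields `(11/4)^(p+1) ≥ 2 n / δ`, which outweighs the dimension, at most `n`.
  have e1 : ((n : ℝ) / 2) ^ (2 * p) = ((n : ℝ) ^ 2 / 11) ^ p * (11 / 4) ^ p := by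
    rw [pow_mul, ← mul_pow]
    congr 1
    ring
  rw [e1, div_le_iff₀ (by positivity)]
  have h2 : Real.exp p ≤ (11 / 4) ^ p := by
    calc Real.exp p = Real.exp ((p : ℕ) * 1) := by rw [mul_one]
      _ = Real.exp 1 ^ p := Real.exp_nat_mul _ _
      _ ≤ _ := pow_le_pow_left₀ (Real.exp_pos 1).le (by linarith [Real.exp_one_lt_d9]) _
  have h3 : 2 * n / δ ≤ (11 / 4) ^ p * (11 / 4 : ℝ) := by
    calc (2 * n / δ : ℝ) = Real.exp A := by
          rw [hA, Real.exp_sub, Real.exp_log (by positivity), Real.exp_log hδ₀]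
      _ ≤ Real.exp (p + 1) := Real.exp_le_exp.2 hp2.le
      _ = Real.exp p * Real.exp 1 := Real.exp_add _ _
      _ ≤ _ := mul_le_mul h2 (by linarith [Real.exp_one_lt_d9]) (Real.exp_pos _).le (by positivity)
  have h4 : (n : ℝ) ≤ 2 * δ * (11 / 4) ^ p := by
    rw [div_le_iff₀ hδ₀] at h3
    nlinarith
  calc (Fintype.card ι : ℝ) * ((n : ℝ) ^ 2 / 11) ^ p ≤ n * ((n : ℝ) ^ 2 / 11) ^ p := by gcongr
    _ ≤ (2 * δ * (11 / 4) ^ p) * ((n : ℝ) ^ 2 / 11) ^ p := by gcongr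
    _ = _ := by ring

end IsBoundedSystem
end

/-- A Hilbert–Schmidt operator is compact. -/
theorem isCompactOperator_of_summable_norm_sq {ι E F : Type*} [NormedAddCommGroup E]
    [InnerProductSpace ℂ E] [CompleteSpace E] [NormedAddCommGroup F] [NormedSpace ℂ F]
    [CompleteSpace F] (b : HilbertBasis ι ℂ E) (T : E →L[ℂ] F)
    (hT : Summable fun i => ‖T (b i)‖ ^ 2) : IsCompactOperator T := by
  classical
  -- Finite-rank truncations. Cauchy–Schwarz and Bessel make the tail of `∑ ‖T (b i)‖²` control
  -- their distance to `T` in operator norm.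
  set S : Finset ι → E →L[ℂ] F := fun s => ∑ i ∈ s, (innerSL ℂ (b i)).smulRight (T (b i)) with hS
  have hSapp : ∀ s f, S s f = ∑ i ∈ s, inner ℂ (b i) f • T (b i) := by
    intro s f
    simp [hS]
  have hlim : ∀ f, Filter.Tendsto (fun s => S s f) Filter.atTop (nhds (T f)) := by
    intro f
    have h := (b.hasSum_repr f).mapL T
    simp only [HasSum] at h
    refine h.congr fun s => ?_
    rw [hSapp]
    exact Finset.sum_congr rfl fun i _ => by rw [map_smul, b.repr_apply_apply]
  have hbound : ∀ ε : ℝ, 0 < ε → ∃ s₀ : Finset ι, ∀ s, s₀ ⊆ s → ‖S s - T‖ ≤ ε := by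
    intro ε hε
    obtain ⟨s₀, hs₀⟩ := summable_iff_vanishing_norm.1 hT (ε ^ 2) (by positivity)
    refine ⟨s₀, fun s hs => ContinuousLinearMap.opNorm_le_bound _ hε.le fun f => ?_⟩
    have h1 : Filter.Tendsto (fun t => ‖S s f - S t f‖) Filter.atTop (nhds ‖S s f - T f‖) :=
      (tendsto_const_nhds.sub (hlim f)).norm
    refine le_of_tendsto h1 (Filter.eventually_atTop.2 ⟨s, fun t (hst : s ⊆ t) => ?_⟩)
    have h2 : S s f - S t f = -∑ i ∈ t \ s, inner ℂ (b i) f • T (b i) := by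
      rw [hSapp, hSapp, ← Finset.sum_sdiff hst]
      abel
    have h3 : ‖∑ i ∈ t \ s, ‖T (b i)‖ ^ 2‖ < ε ^ 2 :=
      hs₀ _ (Finset.disjoint_of_subset_right hs Finset.sdiff_disjoint)
    have h4 : ∑ i ∈ t \ s, ‖inner ℂ (b i) f‖ ^ 2 ≤ ‖f‖ ^ 2 :=
      b.orthonormal.sum_inner_products_le f
    rw [h2, norm_neg]
    refine (norm_sum_le _ _).trans ?_
    simp only [norm_smul]
    refine abs_le_of_sq_le_sq' ?_ (by positivity) |>.2
    refine (Finset.sum_mul_sq_le_sq_mul_sq _ _ _).trans ?_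
    rw [mul_pow, mul_comm]
    exact mul_le_mul ((le_abs_self _).trans h3.le) h4
      (Finset.sum_nonneg fun i _ => by positivity) (by positivity)
  have htend : Filter.Tendsto S Filter.atTop (nhds T) := by
    rw [Metric.tendsto_atTop]
    intro ε hε
    obtain ⟨s₀, hs₀⟩ := hbound (ε / 2) (by positivity)
    refine ⟨s₀, fun s hs => ?_⟩
    rw [dist_eq_norm]
    exact (hs₀ s hs).trans_lt (by linarith)
  refine isCompactOperator_of_tendsto htend (Filter.Eventually.of_forall fun s => ?_)
  have : ∀ i, IsCompactOperator ((innerSL ℂ (b i)).smulRight (T (b i))) := by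
    intro i
    have h1 := isCompactOperator_of_locallyCompactSpace_rng
      (ContinuousLinearMap.toSpanSingleton ℂ (T (b i)))
    exact h1.comp_clm (innerSL ℂ (b i))
  exact (compactOperator (RingHom.id ℂ) E F).sum_mem fun i _ => this i

namespace RKHSLeastSquares

/-! ### Eigenvector expansions for compact positive operators. -/

section Eigensystem

variable {H : Type*} [NormedAddCommGroup H] [InnerProductSpace ℂ H] {W : H →L[ℂ] H}
  {lam : ℕ → ℝ} {e : ℕ → H}

namespace IsEigensystem

theorem inner_eq (he : IsEigensystem W lam e) (j k : ℕ) :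
    inner ℂ (e j) (e k) = if j = k ∧ 0 < lam j then 1 else 0 := by
  have hz : ∀ i, ¬ 0 < lam i → e i = 0 := fun i hi =>
    he.eq_zero i (le_antisymm (not_lt.1 hi) (he.nonneg i))
  by_cases hj : 0 < lam j
  · by_cases hk : 0 < lam k
    · have := orthonormal_iff_ite.1 he.orthonormal ⟨j, hj⟩ ⟨k, hk⟩
      simpa [hj] using this
    · have hjk : j ≠ k := by
        rintro rfl
        exact hk hj
      simp [hz k hk, hjk]
  · simp [hz j hj, hj]

theorem inner_sum_sub (he : IsEigensystem W lam e) (g : H) {s : Finset ℕ} {j : ℕ} (hj : j ∈ s) :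
    inner ℂ (e j) (g - ∑ k ∈ s, inner ℂ (e k) g • e k) = 0 := by
  rw [inner_sub_right, inner_sum, Finset.sum_eq_single j]
  · rw [inner_smul_right, he.inner_eq]
    by_cases h : 0 < lam j
    · simp [h]
    · simp [h, he.eq_zero j (le_antisymm (not_lt.1 h) (he.nonneg j))]
  · intro k _ hk
    rw [inner_smul_right, he.inner_eq]
    simp [hk.symm]
  · simp [hj]

theorem norm_sum_sq (he : IsEigensystem W lam e) (g : H) (s : Finset ℕ) :
    ‖∑ k ∈ s, inner ℂ (e k) g • e k‖ ^ 2 = ∑ k ∈ s, ‖inner ℂ (e k) g‖ ^ 2 := by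
  have h1 : inner ℂ (∑ k ∈ s, inner ℂ (e k) g • e k) (∑ k ∈ s, inner ℂ (e k) g • e k) =
      ((∑ k ∈ s, ‖inner ℂ (e k) g‖ ^ 2 : ℝ) : ℂ) := by
    rw [sum_inner]
    push_cast
    refine Finset.sum_congr rfl fun j hj => ?_
    have h2 := he.inner_sum_sub g hj
    rw [inner_sub_right, sub_eq_zero] at h2
    rw [inner_smul_left, ← h2]
    exact Complex.conj_mul' _
  rw [← inner_self_eq_norm_sq (𝕜 := ℂ), h1]
  exact Complex.ofReal_re _

theorem sum_norm_inner_sq_le (he : IsEigensystem W lam e) (g : H) (s : Finset ℕ) :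
    ∑ k ∈ s, ‖inner ℂ (e k) g‖ ^ 2 ≤ ‖g‖ ^ 2 := by
  rw [← he.norm_sum_sq]
  have h : inner ℂ (∑ k ∈ s, inner ℂ (e k) g • e k) (g - ∑ k ∈ s, inner ℂ (e k) g • e k) = 0 := by
    conv_lhs => rw [sum_inner]
    refine Finset.sum_eq_zero fun j hj => ?_
    rw [inner_smul_left, he.inner_sum_sub g hj, mul_zero]
  have := norm_add_sq_eq_norm_sq_add_norm_sq_of_inner_eq_zero _ _ h
  rw [add_sub_cancel] at this
  nlinarith [norm_nonneg (g - ∑ k ∈ s, inner ℂ (e k) g • e k)]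

/-- Every vector has an eigenvector expansion up to a vector orthogonal to the eigensystem. -/
theorem exists_hasSum [CompleteSpace H] (he : IsEigensystem W lam e) (g : H) :
    ∃ g' : H, HasSum (fun k => inner ℂ (e k) g • e k) g' ∧ ∀ k, inner ℂ (e k) (g - g') = 0 := by
  have hsum := summable_of_sum_le (fun k => sq_nonneg ‖inner ℂ (e k) g‖)
    (he.sum_norm_inner_sq_le g)
  -- For finite sums the squared norm is the sum of squared coefficients, so Bessel's inequality
  -- yields the Cauchy criterion.
  have hc : Summable fun k => inner ℂ (e k) g • e k := by
    refine summable_iff_vanishing_norm.2 fun ε hε => ?_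
    obtain ⟨s, hs⟩ := summable_iff_vanishing_norm.1 hsum (ε ^ 2) (by positivity)
    refine ⟨s, fun t ht => lt_of_pow_lt_pow_left₀ 2 hε.le ?_⟩
    rw [he.norm_sum_sq]
    exact (le_abs_self _).trans_lt (hs t ht)
  obtain ⟨g', hg'⟩ := hc
  refine ⟨g', hg', fun k => ?_⟩
  have h1 : Filter.Tendsto (fun s : Finset ℕ => inner ℂ (e k)
      (g - ∑ k ∈ s, inner ℂ (e k) g • e k)) Filter.atTop (nhds (inner ℂ (e k) (g - g'))) :=
    (tendsto_const_nhds.inner (tendsto_const_nhds.sub hg'))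
  refine tendsto_nhds_unique h1 (tendsto_const_nhds.congr' ?_)
  filter_upwards [Filter.eventually_ge_atTop {k}] with s hs
  rw [he.inner_sum_sub g (Finset.singleton_subset_iff.1 hs)]

/-- A compact positive operator vanishes on the orthogonal complement of an eigensystem. -/
theorem apply_eq_zero [CompleteSpace H] (he : IsEigensystem W lam e) (hc : IsCompactOperator W)
    (hsymm : W.IsSymmetric) (hpos : ∀ f, 0 ≤ (inner ℂ f (W f)).re) {f : H}
    (hf : ∀ k, inner ℂ (e k) f = 0) : W f = 0 := by
  set V : Submodule ℂ H := (Submodule.span ℂ (Set.range e))ᗮ with hV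
  have hmem : ∀ g, g ∈ V ↔ ∀ k, inner ℂ (e k) g = 0 := by
    intro g
    rw [hV, Submodule.mem_orthogonal]
    constructor
    · intro h k
      exact h _ (Submodule.subset_span ⟨k, rfl⟩)
    · intro h u hu
      induction hu using Submodule.span_induction with
      | mem x hx => obtain ⟨k, rfl⟩ := hx; exact h k
      | zero => simp
      | add x y _ _ hx hy => rw [inner_add_left, hx, hy, add_zero]
      | smul a x _ hx => rw [inner_smul_left, hx, mul_zero]
  have hinv : ∀ v ∈ V, W v ∈ V := by
    intro v hv
    rw [hmem] at hv ⊢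
    intro k
    have := hsymm (e k) v
    simp only [ContinuousLinearMap.coe_coe] at this
    rw [← this, he.eigen, inner_smul_left, hv, mul_zero]
  -- The restriction is compact and symmetric, so it is zero unless it has a nonzero eigenvalue.
  -- Such an eigenvalue is real and positive, and completeness puts its eigenvector in the span of
  -- the `e k`, to which it is also orthogonal.
  have h0 : W.restrict hinv = 0 := by
    refine (ContinuousLinearMap.eq_zero_of_forall_hasEigenvalue_eq_zero
      (hc.restrict' (f := (W : H →ₗ[ℂ] H)) hinv) (hsymm.restrict_invariant hinv)).1 fun μ hμ => ?_
    by_contra hμ0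
    obtain ⟨v, hv, hv0⟩ := hμ.exists_hasEigenvector
    have hWv : W (v : H) = μ • (v : H) := by
      have := Module.End.mem_eigenspace_iff.1 hv
      exact congrArg Subtype.val this
    have hreal : (starRingEnd ℂ) μ = μ := by
      have := hsymm (v : H) (v : H)
      simp only [ContinuousLinearMap.coe_coe, hWv, inner_smul_left, inner_smul_right] at this
      refine mul_right_cancel₀ (inner_self_ne_zero.2 ?_) this
      simpa using hv0
    obtain ⟨r, rfl⟩ := Complex.conj_eq_iff_real.1 hreal
    have hr : 0 < r := by
      have h1 := hpos v
      rw [hWv, inner_smul_right, Complex.re_ofReal_mul] at h1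
      have h2 : 0 < (inner ℂ (v : H) (v : H)).re := by
        have : (inner ℂ (v : H) (v : H)).re = ‖(v : H)‖ ^ 2 := inner_self_eq_norm_sq (𝕜 := ℂ) _
        rw [this]
        have : (v : H) ≠ 0 := by simpa using hv0
        positivity
      have h3 : 0 ≤ r := nonneg_of_mul_nonneg_left h1 h2
      exact lt_of_le_of_ne h3 fun h => hμ0 (by simp [← h])
    have hspan := he.complete r hr v hWv
    have h4 : inner ℂ (v : H) (v : H) = 0 :=
      Submodule.mem_orthogonal _ _ |>.1 v.2 _ (Submodule.span_mono (Set.image_subset_range _ _) hspan)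
    exact hv0 (by simpa using h4)
  have := congrArg (fun S => ((S ⟨f, (hmem f).2 hf⟩ : V) : H)) h0
  simpa using this

end IsEigensystem
end Eigensystem
-- The embedding into `L₂` and its kernel.
section Embedding

variable {D H : Type*} [NormedAddCommGroup H] [InnerProductSpace ℂ H] [CompleteSpace H]
  [RKHS ℂ H D ℂ]

theorem norm_kerFun_one_sq_le (hK : IsBoundedKernel H) (x : D) :
    ‖RKHS.kerFun H x 1‖ ^ 2 ≤ ⨆ z : D, ‖scalarKernel H z z‖ := by
  have h1 : ‖RKHS.kerFun H x 1‖ ^ 2 = ‖scalarKernel H x x‖ := by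
    have h2 : scalarKernel H x x = inner ℂ (RKHS.kerFun H x 1) (RKHS.kerFun H x 1) := by
      rw [RKHS.kerFun_inner, RKHS.kerFun_apply]
      simp [scalarKernel]
    rw [h2, inner_self_eq_norm_sq_to_K]
    simp
  rw [h1]
  exact le_ciSup hK x

theorem eval_finset_sum {D H : Type*} [NormedAddCommGroup H] [InnerProductSpace ℂ H]
    [RKHS ℂ H D ℂ] {κ : Type*} (s : Finset κ) (f : κ → H) (x : D) :
    (∑ i ∈ s, f i) x = ∑ i ∈ s, f i x := by
  have h := map_sum (RKHS.coeCLM (H := H) (X := D) (V := ℂ) ℂ) f s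
  have := congrFun h x
  rwa [Finset.sum_apply] at this

variable [MeasurableSpace D] {ρ : Measure D} [IsProbabilityMeasure ρ]
  {hmeas : ∀ f : H, AEStronglyMeasurable f ρ} {hK : IsBoundedKernel H}

theorem embedding_coeFn (f : H) : embedding ρ hmeas hK f =ᵐ[ρ] f :=
  (memLp_of_isBoundedKernel ρ hmeas hK f).coeFn_toLp

theorem inner_embedding (f g : H) :
    inner ℂ (embedding ρ hmeas hK f) (embedding ρ hmeas hK g) = ∫ x, g x * star (f x) ∂ρ := by
  rw [L2.inner_def]
  refine integral_congr_ae ?_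
  filter_upwards [embedding_coeFn (ρ := ρ) (hmeas := hmeas) (hK := hK) f,
    embedding_coeFn (ρ := ρ) (hmeas := hmeas) (hK := hK) g] with x hf hg
  rw [hf, hg]
  rfl

theorem inner_gramOperator_left (f g : H) :
    inner ℂ (gramOperator ρ hmeas hK f) g =
      inner ℂ (embedding ρ hmeas hK f) (embedding ρ hmeas hK g) := by
  rw [gramOperator, ContinuousLinearMap.comp_apply, ContinuousLinearMap.adjoint_inner_left]

theorem inner_gramOperator_right (f g : H) :
    inner ℂ f (gramOperator ρ hmeas hK g) =
      inner ℂ (embedding ρ hmeas hK f) (embedding ρ hmeas hK g) := by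
  rw [gramOperator, ContinuousLinearMap.comp_apply, ContinuousLinearMap.adjoint_inner_right]

theorem norm_embedding_sq (f : H) : ‖embedding ρ hmeas hK f‖ ^ 2 = ∫ x, ‖f x‖ ^ 2 ∂ρ := by
  have h1 := inner_embedding (ρ := ρ) (hmeas := hmeas) (hK := hK) f f
  have h2 : ∀ x, f x * star (f x) = ((‖f x‖ ^ 2 : ℝ) : ℂ) := fun x => by
    push_cast
    exact Complex.mul_conj' _
  simp only [h2] at h1
  have h3 : ∫ x, ((‖f x‖ ^ 2 : ℝ) : ℂ) ∂ρ = ((∫ x, ‖f x‖ ^ 2 ∂ρ : ℝ) : ℂ) := integral_ofReal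
  rw [h3, inner_self_eq_norm_sq_to_K] at h1
  apply Complex.ofReal_injective
  rw [← h1]
  push_cast
  rfl

/-- By Bessel for the kernel function at `x`, `∑ |b i x|² ≤ K(x, x)`. Integrating this bound shows
that the embedding is Hilbert–Schmidt. -/
theorem isCompactOperator_embedding : IsCompactOperator (embedding ρ hmeas hK) := by
  obtain ⟨w, b, -⟩ := exists_hilbertBasis ℂ H
  refine isCompactOperator_of_summable_norm_sq b _ ?_
  refine summable_of_sum_le (fun i => sq_nonneg _) (c := ⨆ z : D, ‖scalarKernel H z z‖) fun s => ?_
  simp only [norm_embedding_sq]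
  have hi : ∀ i, Integrable (fun x => ‖(b i) x‖ ^ 2) ρ := fun i =>
    (memLp_of_isBoundedKernel ρ hmeas hK (b i)).integrable_norm_pow two_ne_zero
  rw [← integral_finsetSum _ fun i _ => hi i]
  have hle : ∀ x, ∑ i ∈ s, ‖(b i) x‖ ^ 2 ≤ ⨆ z : D, ‖scalarKernel H z z‖ := by
    intro x
    refine le_trans ?_ (norm_kerFun_one_sq_le hK x)
    have := b.orthonormal.sum_inner_products_le (RKHS.kerFun H x 1) (s := s)
    simpa using this
  calc _ ≤ ∫ _, ⨆ z : D, ‖scalarKernel H z z‖ ∂ρ :=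
        integral_mono (integrable_finsetSum _ fun i _ => hi i) (integrable_const _) hle
    _ = _ := by simp

theorem isCompactOperator_gramOperator : IsCompactOperator (gramOperator ρ hmeas hK) :=
  isCompactOperator_embedding.clm_comp (embedding ρ hmeas hK).adjoint

theorem embedding_eq_zero_of_gramOperator {f : H} (hf : gramOperator ρ hmeas hK f = 0) :
    embedding ρ hmeas hK f = 0 := by
  have := inner_gramOperator_left (ρ := ρ) (hmeas := hmeas) (hK := hK) f f
  rw [hf, inner_zero_left] at this
  exact inner_self_eq_zero.1 this.symm

/-- Functions in the kernel of the embedding almost surely vanish simultaneously at all nodes. -/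
theorem ae_forall_gramOperator_eq_zero [TopologicalSpace.SeparableSpace H] (n : ℕ) :
    ∀ᵐ X ∂(Measure.pi fun _ : Fin n => ρ), ∀ f : H, gramOperator ρ hmeas hK f = 0 →
      ∀ i, f (X i) = 0 := by
  let S : Set H := {f | gramOperator ρ hmeas hK f = 0}
  have : SecondCountableTopology H := UniformSpace.secondCountable_of_separable H
  have : Nonempty S := ⟨⟨0, map_zero _⟩⟩
  -- Each function in the kernel has its own exceptional null set. A countable dense family makes
  -- the null set common, and continuity of point evaluation extends the vanishing to the whole
  -- kernel.
  let u : ℕ → S := TopologicalSpace.denseSeq S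
  have h1 : ∀ᵐ X ∂(Measure.pi fun _ : Fin n => ρ), ∀ (j : ℕ) (i : Fin n), (u j : H) (X i) = 0 := by
    rw [ae_all_iff]
    intro j
    rw [ae_all_iff]
    intro i
    have h2 : ∀ᵐ x ∂ρ, (u j : H) x = 0 := by
      have h3 := embedding_coeFn (ρ := ρ) (hmeas := hmeas) (hK := hK) (u j : H)
      rw [embedding_eq_zero_of_gramOperator (u j).2] at h3
      filter_upwards [h3, Lp.coeFn_zero ℂ 2 ρ] with x hx hx0
      rw [← hx, hx0]
      rfl
    exact (measurePreserving_eval (fun _ : Fin n => ρ) i).quasiMeasurePreserving.ae h2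
  filter_upwards [h1] with X hX f hf i
  have hcl : IsClosed {g : S | (g : H) (X i) = 0} :=
    isClosed_eq ((RKHS.continuous_eval (X i)).comp continuous_subtype_val) continuous_const
  have hsub : Set.range u ⊆ {g : S | (g : H) (X i) = 0} := by
    rintro _ ⟨j, rfl⟩
    exact hX j i
  have := hcl.closure_subset_iff.2 hsub
  rw [(TopologicalSpace.denseRange_denseSeq S).closure_range] at this
  exact this (Set.mem_univ (⟨f, hf⟩ : S))

end Embedding

/-! ### Eigenfunctions as bounded systems, and estimates on the spectral tail. -/

section System

variable {D H : Type*} [NormedAddCommGroup H] [InnerProductSpace ℂ H] [CompleteSpace H]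
  [RKHS ℂ H D ℂ] [MeasurableSpace D] {ρ : Measure D} [IsProbabilityMeasure ρ]
  {hmeas : ∀ f : H, AEStronglyMeasurable f ρ} {hK : IsBoundedKernel H}
  {lam : ℕ → ℝ} {e : ℕ → H}

namespace IsEigensystem

theorem gramOperator_eq_zero (he : IsEigensystem (gramOperator ρ hmeas hK) lam e) {f : H}
    (hf : ∀ k, inner ℂ (e k) f = 0) : gramOperator ρ hmeas hK f = 0 := by
  refine he.apply_eq_zero isCompactOperator_gramOperator (fun f g => ?_) (fun f => ?_) hf
  · simp only [ContinuousLinearMap.coe_coe]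
    rw [inner_gramOperator_left, inner_gramOperator_right]
  · rw [inner_gramOperator_right]
    exact inner_self_nonneg (𝕜 := ℂ)

theorem sum_norm_apply_sq_le (he : IsEigensystem (gramOperator ρ hmeas hK) lam e) (x : D)
    (s : Finset ℕ) : ∑ k ∈ s, ‖e k x‖ ^ 2 ≤ ⨆ z : D, ‖scalarKernel H z z‖ := by
  refine le_trans ?_ (norm_kerFun_one_sq_le hK x)
  have := he.sum_norm_inner_sq_le (RKHS.kerFun H x 1) s
  simpa using this

theorem inner_embedding (he : IsEigensystem (gramOperator ρ hmeas hK) lam e) (j k : ℕ) :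
    inner ℂ (embedding ρ hmeas hK (e j)) (embedding ρ hmeas hK (e k)) =
      if j = k then (lam j : ℂ) else 0 := by
  rw [← inner_gramOperator_left, he.eigen, inner_smul_left, he.inner_eq]
  by_cases hj : 0 < lam j
  · by_cases hjk : j = k
    · rw [if_pos ⟨hjk, hj⟩, if_pos hjk, mul_one, Complex.conj_ofReal]
    · simp [hjk]
  · have : lam j = 0 := le_antisymm (not_lt.1 hj) (he.nonneg j)
    simp [this]

theorem inner_embedding_eta (he : IsEigensystem (gramOperator ρ hmeas hK) lam e) {j k : ℕ}
    (hj : 0 < lam j) :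
    inner ℂ (embedding ρ hmeas hK (eta lam e j)) (embedding ρ hmeas hK (eta lam e k)) =
      if j = k then 1 else 0 := by
  simp only [eta, map_smul]
  rw [inner_smul_left, inner_smul_right, he.inner_embedding]
  by_cases hjk : j = k
  · subst hjk
    simp only [if_true, Complex.conj_ofReal]
    rw [← Complex.ofReal_mul, ← Complex.ofReal_mul, ← Complex.ofReal_one]
    congr 1
    have := Real.sqrt_pos.2 hj
    have h2 := Real.mul_self_sqrt hj.le
    field_simp
    linarith
  · simp [hjk]

/-- The matrix estimates need a finite index set, so the tail is cut after `M` terms. The bound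
`T(m)` does not depend on `M`; its supremum is finite by Bessel for the kernel functions. -/
theorem tail_isBoundedSystem (he : IsEigensystem (gramOperator ρ hmeas hK) lam e) (m M : ℕ) :
    IsBoundedSystem ρ (fun x (k : Fin M) => e (m - 1 + k) x) (fun k => lam (m - 1 + k))
      (tailFunction (D := D) e m) where
  aestronglyMeasurable k := hmeas _
  sum_le x := by
    have hbd : ∀ (x : D) (s : Finset ℕ),
        ∑ k ∈ s, ‖e (m - 1 + k) x‖ ^ 2 ≤ ⨆ z : D, ‖scalarKernel H z z‖ := by
      intro x s
      have := he.sum_norm_apply_sq_le x (s.map (addLeftEmbedding (m - 1)))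
      simpa using this
    have hs : ∀ x : D, Summable fun k => ‖e (m - 1 + k) x‖ ^ 2 := fun x =>
      summable_of_sum_le (fun k => sq_nonneg _) (hbd x)
    have h1 : ∑ k : Fin M, ‖e (m - 1 + k) x‖ ^ 2 ≤ ∑' k, ‖e (m - 1 + k) x‖ ^ 2 := by
      rw [Fin.sum_univ_eq_sum_range (fun k => ‖e (m - 1 + k) x‖ ^ 2)]
      exact (hs x).sum_le_tsum _ fun k _ => by positivity
    refine h1.trans (le_ciSup (f := fun x : D => ∑' k, ‖e (m - 1 + k) x‖ ^ 2) ?_ x)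
    refine ⟨⨆ z : D, ‖scalarKernel H z z‖, ?_⟩
    rintro _ ⟨z, rfl⟩
    exact (hs z).tsum_le_of_sum_le (hbd z)
  integral_mul k l := by
    rw [← RKHSLeastSquares.inner_embedding (ρ := ρ) (hmeas := hmeas) (hK := hK)
      (e (m - 1 + l)) (e (m - 1 + k)), he.inner_embedding]
    by_cases hkl : k = l
    · simp [hkl]
    · have : ¬ ((l : ℕ) = k) := by
        intro h
        exact hkl (Fin.ext h.symm)
      simp [hkl, this]

/-- Positivity of the first `m - 1` eigenvalues makes the `eta` orthonormal in `L₂`, so the mean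
matrix is the identity. -/
theorem eta_isBoundedSystem (he : IsEigensystem (gramOperator ρ hmeas hK) lam e) (m : ℕ)
    (hpos : ∀ k : ℕ, k + 1 < m → 0 < lam k) :
    IsBoundedSystem ρ (fun x (k : Fin (m - 1)) => eta lam e k x) (fun _ => 1)
      (spectralFunction (D := D) lam e m) where
  aestronglyMeasurable k := hmeas _
  sum_le x := by
    rw [Fin.sum_univ_eq_sum_range (fun k => ‖eta lam e k x‖ ^ 2)]
    refine le_ciSup (f := fun x : D => ∑ k ∈ Finset.range (m - 1), ‖eta lam e k x‖ ^ 2) ?_ x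
    refine ⟨∑ k ∈ Finset.range (m - 1), ‖(((√(lam k))⁻¹ : ℝ) : ℂ)‖ ^ 2 *
      ⨆ z : D, ‖scalarKernel H z z‖, ?_⟩
    rintro _ ⟨z, rfl⟩
    refine Finset.sum_le_sum fun k _ => ?_
    rw [eta, RKHS.coe_smul, Pi.smul_apply, norm_smul, mul_pow]
    have := he.sum_norm_apply_sq_le z {k}
    rw [Finset.sum_singleton] at this
    gcongr
  integral_mul k l := by
    have hl := l.2
    rw [← RKHSLeastSquares.inner_embedding (ρ := ρ) (hmeas := hmeas) (hK := hK)
      (eta lam e l) (eta lam e k), he.inner_embedding_eta (hpos l (by omega))]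
    by_cases hkl : k = l
    · simp [hkl]
    · have : ¬ ((l : ℕ) = k) := by
        intro h
        exact hkl (Fin.ext h.symm)
      simp [hkl, this]

theorem norm_embedding_sum_sq (he : IsEigensystem (gramOperator ρ hmeas hK) lam e) (g : H)
    (s : Finset ℕ) : ‖embedding ρ hmeas hK (∑ k ∈ s, inner ℂ (e k) g • e k)‖ ^ 2 =
      ∑ k ∈ s, lam k * ‖inner ℂ (e k) g‖ ^ 2 := by
  have h1 : inner ℂ (embedding ρ hmeas hK (∑ k ∈ s, inner ℂ (e k) g • e k))
      (embedding ρ hmeas hK (∑ k ∈ s, inner ℂ (e k) g • e k)) =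
      ((∑ k ∈ s, lam k * ‖inner ℂ (e k) g‖ ^ 2 : ℝ) : ℂ) := by
    rw [map_sum, sum_inner]
    push_cast
    refine Finset.sum_congr rfl fun j hj => ?_
    rw [inner_sum, Finset.sum_eq_single j]
    · rw [map_smul, inner_smul_left, inner_smul_right, he.inner_embedding, if_pos rfl, ← mul_assoc,
        Complex.conj_mul']
      ring
    · intro k _ hk
      rw [map_smul, map_smul, inner_smul_left, inner_smul_right, he.inner_embedding,
        if_neg hk.symm]
      simp
    · simp [hj]
  rw [← inner_self_eq_norm_sq (𝕜 := ℂ), h1]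
  exact Complex.ofReal_re _

theorem embedding_eq_of_hasSum (he : IsEigensystem (gramOperator ρ hmeas hK) lam e) {g g' : H}
    (h : ∀ k, inner ℂ (e k) (g - g') = 0) :
    embedding ρ hmeas hK g = embedding ρ hmeas hK g' := by
  have := embedding_eq_zero_of_gramOperator (he.gramOperator_eq_zero h)
  rwa [map_sub, sub_eq_zero] at this

/-- The embedding restricted to the orthogonal complement of the first `p` eigenvectors. -/
theorem norm_embedding_sq_le (he : IsEigensystem (gramOperator ρ hmeas hK) lam e) {g : H} {p : ℕ}
    (hg : ∀ k < p, inner ℂ (e k) g = 0) :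
    ‖embedding ρ hmeas hK g‖ ^ 2 ≤ lam p * ‖g‖ ^ 2 := by
  obtain ⟨g', hg', horth⟩ := he.exists_hasSum g
  rw [he.embedding_eq_of_hasSum horth]
  have h1 : Filter.Tendsto (fun s : Finset ℕ =>
      ‖embedding ρ hmeas hK (∑ k ∈ s, inner ℂ (e k) g • e k)‖ ^ 2) Filter.atTop
      (nhds (‖embedding ρ hmeas hK g'‖ ^ 2)) :=
    ((((embedding ρ hmeas hK).continuous.tendsto g').comp hg').norm).pow 2
  refine le_of_tendsto h1 (Filter.Eventually.of_forall fun s => ?_)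
  rw [he.norm_embedding_sum_sq]
  calc _ ≤ ∑ k ∈ s, lam p * ‖inner ℂ (e k) g‖ ^ 2 := by
        refine Finset.sum_le_sum fun k _ => ?_
        rcases lt_or_ge k p with h | h
        · simp [hg k h]
        · exact mul_le_mul_of_nonneg_right (he.antitone h) (sq_nonneg _)
    _ ≤ lam p * ‖g‖ ^ 2 := by
        rw [← Finset.mul_sum]
        exact mul_le_mul_of_nonneg_left (he.sum_norm_inner_sq_le g s) (he.nonneg p)

/-- Sampling bound on the orthogonal complement of the first `p` eigenvectors. -/
theorem sum_norm_sample_sq_le (he : IsEigensystem (gramOperator ρ hmeas hK) lam e) {g : H} {p : ℕ}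
    (hg : ∀ k < p, inner ℂ (e k) g = 0) {n : ℕ} {X : Fin n → D} {t : ℝ} (ht : 0 ≤ t)
    (hX0 : ∀ f : H, gramOperator ρ hmeas hK f = 0 → ∀ i, f (X i) = 0)
    (hX : ∀ (M : ℕ) (c : Fin M → ℂ),
      ∑ i, ‖∑ k, star (c k) * e (p + k) (X i)‖ ^ 2 ≤ t * ∑ k, ‖c k‖ ^ 2) :
    ∑ i, ‖g (X i)‖ ^ 2 ≤ t * ‖g‖ ^ 2 := by
  obtain ⟨g', hg', horth⟩ := he.exists_hasSum g
  have hgg : ∀ i, g (X i) = g' (X i) := by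
    intro i
    have := hX0 _ (he.gramOperator_eq_zero horth) i
    rw [RKHS.coe_sub, Pi.sub_apply, sub_eq_zero] at this
    exact this
  simp only [hgg]
  -- Partial sums of length `M + p` lose their first `p` terms by orthogonality and become
  -- truncations of length `M`.
  have hlim := (Filter.tendsto_add_atTop_iff_nat p).2 hg'.tendsto_sum_nat
  have h1 : Filter.Tendsto (fun M : ℕ => ∑ i,
      ‖(∑ k ∈ Finset.range (M + p), inner ℂ (e k) g • e k : H) (X i)‖ ^ 2) Filter.atTop
      (nhds (∑ i, ‖g' (X i)‖ ^ 2)) :=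
    tendsto_finsetSum _ fun i _ =>
      ((((RKHS.continuous_eval (X i)).tendsto g').comp hlim).norm).pow 2
  refine le_of_tendsto h1 (Filter.Eventually.of_forall fun M => ?_)
  have h2 : ∑ k ∈ Finset.range (M + p), inner ℂ (e k) g • e k =
      ∑ k : Fin M, inner ℂ (e (p + k)) g • e (p + k) := by
    rw [add_comm, Finset.sum_range_add, Finset.sum_eq_zero fun k hk => by
      rw [hg k (Finset.mem_range.1 hk), zero_smul], zero_add,
      Fin.sum_univ_eq_sum_range (fun k => inner ℂ (e (p + k)) g • e (p + k))]
  rw [h2]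
  have h3 := hX M fun k => star (inner ℂ (e (p + k)) g)
  simp only [star_star, norm_star] at h3
  simp only [eval_finset_sum, RKHS.coe_smul, Pi.smul_apply, smul_eq_mul]
  refine h3.trans (mul_le_mul_of_nonneg_left ?_ ht)
  have := he.sum_norm_inner_sq_le g ((Finset.range M).map (addLeftEmbedding p))
  rw [Finset.sum_map] at this
  rw [Fin.sum_univ_eq_sum_range (fun k => ‖inner ℂ (e (p + k)) g‖ ^ 2)]
  simpa using this

end IsEigensystem
end System
-- Linear algebra of least squares.
section LeastSquares
open scoped ComplexOrder

variable {n p : ℕ} {L : Matrix (Fin n) (Fin p) ℂ}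

theorem rank_eq_iff_det_ne_zero (L : Matrix (Fin n) (Fin p) ℂ) :
    L.rank = p ↔ (Lᴴ * L).det ≠ 0 := by
  rw [← Matrix.rank_conjTranspose_mul_self]
  constructor
  · intro h
    have h1 := LinearMap.finrank_range_add_finrank_ker (Lᴴ * L).mulVecLin
    rw [← Matrix.rank, h, Module.finrank_pi, Fintype.card_fin] at h1
    have h2 : LinearMap.ker (Lᴴ * L).mulVecLin = ⊥ := Submodule.finrank_eq_zero.1 (by omega)
    have h3 : Function.Injective (Lᴴ * L).mulVec := LinearMap.ker_eq_bot.1 h2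
    exact ((Matrix.isUnit_iff_isUnit_det _).1 (Matrix.mulVec_injective_iff_isUnit.1 h3)).ne_zero
  · intro h
    simpa using Matrix.rank_of_det_ne_zero (A := Lᴴ * L) h

theorem det_ne_zero_of_le {a : ℝ} (ha : 0 < a)
    (h : ∀ c : Fin p → ℂ, a * ∑ k, ‖c k‖ ^ 2 ≤ ∑ i, ‖(L *ᵥ c) i‖ ^ 2) : (Lᴴ * L).det ≠ 0 := by
  intro hdet
  obtain ⟨v, hv, hv0⟩ := Matrix.exists_mulVec_eq_zero_iff.2 hdet
  rw [Matrix.conjTranspose_mul_self_mulVec_eq_zero] at hv0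
  have h1 := h v
  simp only [hv0, Pi.zero_apply, norm_zero, ne_eq, OfNat.ofNat_ne_zero, not_false_eq_true, zero_pow,
    Finset.sum_const_zero] at h1
  refine hv (funext fun k => ?_)
  have h2 : ∑ k, ‖v k‖ ^ 2 ≤ 0 := by nlinarith
  have h3 := (Finset.single_le_sum (f := fun k => ‖v k‖ ^ 2) (fun k _ => by positivity)
    (Finset.mem_univ k)).trans h2
  have h4 : ‖v k‖ = 0 := pow_eq_zero_iff two_ne_zero |>.1 (le_antisymm h3 (by positivity))
  simpa using h4

theorem leastSquares_add (y z : Fin n → ℂ) :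
    leastSquares L (y + z) = leastSquares L y + leastSquares L z :=
  Matrix.mulVec_add _ _ _

theorem leastSquares_mulVec (h : (Lᴴ * L).det ≠ 0) (c : Fin p → ℂ) :
    leastSquares L (L *ᵥ c) = c := by
  rw [leastSquares, Matrix.mulVec_mulVec, Matrix.mul_assoc,
    Matrix.nonsing_inv_mul _ (isUnit_iff_ne_zero.2 h), Matrix.one_mulVec]

/-- The least squares fit is the orthogonal projection of the data, hence bounded by it. -/
theorem sum_norm_mulVec_leastSquares_sq_le (h : (Lᴴ * L).det ≠ 0) (y : Fin n → ℂ) :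
    ∑ i, ‖(L *ᵥ leastSquares L y) i‖ ^ 2 ≤ ∑ i, ‖y i‖ ^ 2 := by
  set u := L *ᵥ leastSquares L y with hu
  -- The normal equations: the residual is orthogonal to the range of `L`, so `⟨u, u⟩ = ⟨u, y⟩`.
  have h1 : Lᴴ *ᵥ u = Lᴴ *ᵥ y := by
    rw [hu, leastSquares, Matrix.mulVec_mulVec, Matrix.mulVec_mulVec,
      ← Matrix.mul_assoc, Matrix.mul_nonsing_inv _ (isUnit_iff_ne_zero.2 h), Matrix.one_mul]
  have h2 : ∀ z, star u ⬝ᵥ z = star (leastSquares L y) ⬝ᵥ (Lᴴ *ᵥ z) := by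
    intro z
    rw [hu, Matrix.star_mulVec, ← Matrix.dotProduct_mulVec]
  have h3 : star u ⬝ᵥ u = star u ⬝ᵥ y := by rw [h2, h2, h1]
  have h4 : (star u ⬝ᵥ u).re = ∑ i, ‖u i‖ ^ 2 := by
    simp only [dotProduct, Complex.re_sum, Pi.star_apply]
    refine Finset.sum_congr rfl fun i _ => ?_
    have : star (u i) * u i = ((‖u i‖ ^ 2 : ℝ) : ℂ) := by
      push_cast
      exact Complex.conj_mul' _
    rw [this, Complex.ofReal_re]
  have h5 : (star u ⬝ᵥ y).re ≤ ∑ i, (‖u i‖ ^ 2 + ‖y i‖ ^ 2) / 2 := by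
    simp only [dotProduct, Complex.re_sum, Pi.star_apply]
    refine Finset.sum_le_sum fun i _ => (Complex.re_le_norm _).trans ?_
    rw [norm_mul, norm_star]
    linarith [two_mul_le_add_sq ‖u i‖ ‖y i‖]
  rw [← h3, h4, ← Finset.sum_div, Finset.sum_add_distrib] at h5
  linarith

end LeastSquares

/-! ### Sampling matrices: continuity and measurability. -/

section Sampling

variable {D H : Type*} [NormedAddCommGroup H] [InnerProductSpace ℂ H] [RKHS ℂ H D ℂ]
  {lam : ℕ → ℝ} {e : ℕ → H}

theorem sampleMatrix_mulVec (m : ℕ) {n : ℕ} (X : Fin n → D) (c : Fin (m - 1) → ℂ) (i : Fin n) :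
    (sampleMatrix lam e m X *ᵥ c) i = (∑ k : Fin (m - 1), c k • eta lam e k : H) (X i) := by
  rw [eval_finset_sum]
  simp only [Matrix.mulVec, dotProduct, sampleMatrix, Matrix.of_apply, RKHS.coe_smul,
    Pi.smul_apply, smul_eq_mul, mul_comm]

theorem continuous_approximant (m : ℕ) {n : ℕ} (X : Fin n → D) :
    Continuous (approximant lam e m X : H → H) := by
  unfold approximant leastSquares
  refine continuous_finsetSum _ fun k _ => Continuous.smul ?_ continuous_const
  have h : Continuous fun f : H => (fun i => f (X i) : Fin n → ℂ) :=
    continuous_pi fun i => RKHS.continuous_eval (X i)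
  exact (continuous_apply k).comp (continuous_const.matrix_mulVec h)

variable [MeasurableSpace D] {ρ : Measure D} [IsProbabilityMeasure ρ]

theorem aemeasurable_sampleMatrix (hmeas : ∀ f : H, AEStronglyMeasurable f ρ) (m n : ℕ) :
    AEMeasurable (fun X : Fin n → D => (fun i k => sampleMatrix lam e m X i k :
      Fin n → Fin (m - 1) → ℂ)) (Measure.pi fun _ => ρ) := by
  refine aemeasurable_pi_iff.2 fun i => aemeasurable_pi_iff.2 fun k => ?_
  exact ((hmeas (eta lam e k)).comp_measurePreserving
    (measurePreserving_eval (fun _ => ρ) i)).aemeasurable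

theorem aemeasurable_det (hmeas : ∀ f : H, AEStronglyMeasurable f ρ) (m n : ℕ) :
    AEMeasurable (fun X : Fin n → D =>
      ((sampleMatrix lam e m X)ᴴ * sampleMatrix lam e m X).det) (Measure.pi fun _ => ρ) := by
  have hc : Continuous fun A : Fin n → Fin (m - 1) → ℂ =>
      ((Matrix.of A)ᴴ * Matrix.of A).det := by
    have h : Continuous fun A : Fin n → Fin (m - 1) → ℂ => Matrix.of A := continuous_id
    exact (h.matrix_conjTranspose.matrix_mul h).matrix_det
  exact hc.measurable.comp_aemeasurable (aemeasurable_sampleMatrix hmeas m n)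

theorem aemeasurable_leastSquares (hmeas : ∀ f : H, AEStronglyMeasurable f ρ) (m n : ℕ) (f : H)
    (k : Fin (m - 1)) :
    AEMeasurable (fun X : Fin n → D => leastSquares (sampleMatrix lam e m X) (fun i => f (X i)) k)
      (Measure.pi fun _ => ρ) := by
  have hc : Continuous fun A : (Fin n → Fin (m - 1) → ℂ) × (Fin n → ℂ) =>
      ((((Matrix.of A.1)ᴴ * Matrix.of A.1).adjugate * (Matrix.of A.1)ᴴ) *ᵥ A.2) k := by
    have h : Continuous fun A : (Fin n → Fin (m - 1) → ℂ) × (Fin n → ℂ) => Matrix.of A.1 :=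
      continuous_fst
    exact (continuous_apply k).comp ((((h.matrix_conjTranspose.matrix_mul h).matrix_adjugate).matrix_mul
      h.matrix_conjTranspose).matrix_mulVec continuous_snd)
  have hf : AEMeasurable (fun X : Fin n → D => (fun i => f (X i))) (Measure.pi fun _ => ρ) :=
    aemeasurable_pi_iff.2 fun i => ((hmeas f).comp_measurePreserving
      (measurePreserving_eval (fun _ => ρ) i)).aemeasurable
  have h1 := (aemeasurable_det (lam := lam) (e := e) hmeas m n).inv.mul
    (hc.measurable.comp_aemeasurable
      ((aemeasurable_sampleMatrix (lam := lam) (e := e) hmeas m n).prodMk hf))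
  -- The formula by determinant and adjugate also holds at singular Gram matrices, where both
  -- inverses take the default value zero, so no nodes need to be excluded.
  refine h1.congr (Filter.Eventually.of_forall fun X => ?_)
  change _ = leastSquares (sampleMatrix lam e m X) (fun i => f (X i)) k
  rw [leastSquares, Matrix.inv_def, Ring.inverse_eq_inv', Matrix.smul_mul, Matrix.smul_mulVec,
    Pi.smul_apply, smul_eq_mul]
  rfl

end Sampling

/-! ### The error for fixed nodes, and measurability of the event. -/

section Error

variable {D H : Type*} [NormedAddCommGroup H] [InnerProductSpace ℂ H] [CompleteSpace H]
  [RKHS ℂ H D ℂ] [MeasurableSpace D] {ρ : Measure D} [IsProbabilityMeasure ρ]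
  {hmeas : ∀ f : H, AEStronglyMeasurable f ρ} {hK : IsBoundedKernel H}
  {lam : ℕ → ℝ} {e : ℕ → H}

/-- The deterministic half of the argument: exactness on the first eigenfunctions leaves only the
component `g`, and stability of the fit bounds its coefficients by the samples of `g`. -/
theorem IsEigensystem.norm_sub_approximant_sq_le
    (he : IsEigensystem (gramOperator ρ hmeas hK) lam e) {m : ℕ}
    (hpos : ∀ k : ℕ, k + 1 < m → 0 < lam k) {n : ℕ} {X : Fin n → D} {a t : ℝ} (ha : 0 < a)
    (ht : 0 ≤ t)
    (hX0 : ∀ f : H, gramOperator ρ hmeas hK f = 0 → ∀ i, f (X i) = 0)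
    (hX1 : ∀ c : Fin (m - 1) → ℂ,
      a * ∑ k, ‖c k‖ ^ 2 ≤ ∑ i, ‖(sampleMatrix lam e m X *ᵥ c) i‖ ^ 2)
    (hX2 : ∀ (M : ℕ) (c : Fin M → ℂ),
      ∑ i, ‖∑ k, star (c k) * e (m - 1 + k) (X i)‖ ^ 2 ≤ t * ∑ k, ‖c k‖ ^ 2)
    {f : H} (hf : ‖f‖ ≤ 1) :
    ‖embedding ρ hmeas hK (f - approximant lam e m X f)‖ ^ 2 ≤ lam (m - 1) + t / a := by
  set p := m - 1 with hp
  have hlam : ∀ k : Fin p, 0 < lam k := fun k => hpos k (by have := k.2; omega)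
  have hdet := det_ne_zero_of_le ha hX1
  set L := sampleMatrix lam e m X with hL
  set g := f - ∑ k ∈ Finset.range p, inner ℂ (e k) f • e k with hg
  have hgo : ∀ k < p, inner ℂ (e k) g = 0 := fun k hk =>
    he.inner_sum_sub f (Finset.mem_range.2 hk)
  have hgn : ‖g‖ ^ 2 ≤ 1 := by
    have h1 : inner ℂ (∑ k ∈ Finset.range p, inner ℂ (e k) f • e k) g = 0 := by
      rw [sum_inner]
      refine Finset.sum_eq_zero fun k hk => ?_
      rw [inner_smul_left, hgo k (Finset.mem_range.1 hk), mul_zero]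
    have h2 := norm_add_sq_eq_norm_sq_add_norm_sq_of_inner_eq_zero _ _ h1
    rw [hg, add_sub_cancel] at h2
    rw [hg]
    nlinarith [norm_nonneg f, norm_nonneg (∑ k ∈ Finset.range p, inner ℂ (e k) f • e k)]
  set c₀ : Fin p → ℂ := fun k => inner ℂ (e k) f * ((√(lam k) : ℝ) : ℂ) with hc₀
  have hsum : ∑ k ∈ Finset.range p, inner ℂ (e k) f • e k = ∑ k : Fin p, c₀ k • eta lam e k := by
    rw [← Fin.sum_univ_eq_sum_range (fun k => inner ℂ (e k) f • e k)]
    refine Finset.sum_congr rfl fun k _ => ?_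
    have h1 : ((√(lam k) : ℝ) : ℂ) ≠ 0 :=
      Complex.ofReal_ne_zero.2 (Real.sqrt_pos.2 (hlam k)).ne'
    rw [eta, smul_smul, hc₀, Complex.ofReal_inv, mul_assoc, mul_inv_cancel₀ h1, mul_one]
  set d := leastSquares L (fun i => g (X i)) with hd
  have happ : f - approximant lam e m X f = g - ∑ k : Fin p, d k • eta lam e k := by
    have h1 : (fun i => f (X i)) = L *ᵥ c₀ + fun i => g (X i) := by
      funext i
      rw [Pi.add_apply, hL, sampleMatrix_mulVec, ← hsum, hg, RKHS.coe_sub, Pi.sub_apply,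
        add_sub_cancel]
    rw [approximant, h1, leastSquares_add, leastSquares_mulVec hdet, ← hd]
    simp only [Pi.add_apply, add_smul, Finset.sum_add_distrib]
    rw [hg, hsum]
    abel
  have hdn : ∑ k, ‖d k‖ ^ 2 ≤ t / a := by
    rw [le_div_iff₀' ha]
    calc _ ≤ ∑ i, ‖(L *ᵥ d) i‖ ^ 2 := hX1 d
      _ ≤ ∑ i, ‖g (X i)‖ ^ 2 := sum_norm_mulVec_leastSquares_sq_le hdet _
      _ ≤ t * ‖g‖ ^ 2 := he.sum_norm_sample_sq_le hgo ht hX0 hX2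
      _ ≤ t := mul_le_of_le_one_right ht hgn
  -- Moving `Id* Id` onto the eigenvectors turns `H`-orthogonality into `L₂`-orthogonality. The two
  -- error parts then add by Pythagoras, without a factor 2.
  have horth : inner ℂ (embedding ρ hmeas hK g)
      (embedding ρ hmeas hK (∑ k : Fin p, d k • eta lam e k)) = 0 := by
    rw [← inner_gramOperator_right, map_sum, inner_sum]
    refine Finset.sum_eq_zero fun k _ => ?_
    rw [map_smul, eta, map_smul, he.eigen, inner_smul_right, inner_smul_right, inner_smul_right,
      ← inner_conj_symm, hgo k k.2]
    simp
  have hnd : ‖embedding ρ hmeas hK (∑ k : Fin p, d k • eta lam e k)‖ ^ 2 = ∑ k, ‖d k‖ ^ 2 := by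
    have h1 : inner ℂ (embedding ρ hmeas hK (∑ k : Fin p, d k • eta lam e k))
        (embedding ρ hmeas hK (∑ k : Fin p, d k • eta lam e k)) =
        ((∑ k, ‖d k‖ ^ 2 : ℝ) : ℂ) := by
      rw [map_sum, sum_inner]
      push_cast
      refine Finset.sum_congr rfl fun j _ => ?_
      rw [inner_sum, Finset.sum_eq_single j]
      · rw [map_smul, inner_smul_left, inner_smul_right, he.inner_embedding_eta (hlam j),
          if_pos rfl, mul_one]
        exact Complex.conj_mul' _
      · intro k _ hk
        rw [map_smul, map_smul, inner_smul_left, inner_smul_right,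
          he.inner_embedding_eta (hlam j), if_neg fun h => hk (Fin.ext h.symm)]
        simp
      · simp
    rw [← inner_self_eq_norm_sq (𝕜 := ℂ), h1]
    exact Complex.ofReal_re _
  have hpyth : ‖embedding ρ hmeas hK (f - approximant lam e m X f)‖ ^ 2 =
      ‖embedding ρ hmeas hK g‖ ^ 2 + ∑ k, ‖d k‖ ^ 2 := by
    rw [happ, map_sub, ← hnd, norm_sub_sq (𝕜 := ℂ), horth]
    simp
  rw [hpyth]
  refine add_le_add ((he.norm_embedding_sq_le hgo).trans ?_) hdn
  exact mul_le_of_le_one_right (he.nonneg p) hgn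

theorem worstCaseErrorSq_le_iff {m n : ℕ} {X : Fin n → D} {c : ℝ≥0∞} :
    worstCaseErrorSq ρ hmeas hK lam e m X ≤ c ↔
      ∀ f : H, ‖f‖ ≤ 1 → ‖embedding ρ hmeas hK (f - approximant lam e m X f)‖ₑ ^ 2 ≤ c := by
  simp only [worstCaseErrorSq, iSup_le_iff]

theorem aemeasurable_enorm_error (m n : ℕ) (f : H) :
    AEMeasurable (fun X : Fin n → D =>
      ‖embedding ρ hmeas hK (f - approximant lam e m X f)‖ₑ ^ 2) (Measure.pi fun _ => ρ) := by
  refine AEMeasurable.pow_const (AEStronglyMeasurable.enorm ?_) 2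
  simp only [map_sub, approximant, map_sum, map_smul]
  refine aestronglyMeasurable_const.sub ?_
  refine Finset.aestronglyMeasurable_fun_sum _ fun k _ => ?_
  exact (aemeasurable_leastSquares hmeas m n f k).aestronglyMeasurable.smul
    aestronglyMeasurable_const

/-- For fixed nodes the error depends continuously on `f`, so the supremum over the unit ball may be
tested on a countable dense subset. -/
theorem nullMeasurableSet_event [TopologicalSpace.SeparableSpace H] (m n : ℕ) (c : ℝ≥0∞) :
    NullMeasurableSet {X : Fin n → D | (sampleMatrix lam e m X).rank = m - 1 ∧
      worstCaseErrorSq ρ hmeas hK lam e m X ≤ c} (Measure.pi fun _ => ρ) := by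
  have : SecondCountableTopology H := UniformSpace.secondCountable_of_separable H
  let S : Set H := {f | ‖f‖ ≤ 1}
  have : Nonempty S := ⟨⟨0, by simp [S]⟩⟩
  let u : ℕ → S := TopologicalSpace.denseSeq S
  have heq : {X : Fin n → D | (sampleMatrix lam e m X).rank = m - 1 ∧
      worstCaseErrorSq ρ hmeas hK lam e m X ≤ c} =
      {X | ((sampleMatrix lam e m X)ᴴ * sampleMatrix lam e m X).det = 0}ᶜ ∩
      ⋂ j, {X | ‖embedding ρ hmeas hK ((u j : H) - approximant lam e m X (u j))‖ₑ ^ 2 ≤ c} := by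
    ext X
    simp only [Set.mem_ofPred_eq, Set.mem_inter_iff, Set.mem_compl_iff, Set.mem_iInter,
      rank_eq_iff_det_ne_zero, worstCaseErrorSq_le_iff, ne_eq]
    refine and_congr_right fun _ => ⟨fun h j => h _ (u j).2, fun h f hf => ?_⟩
    have hcl : IsClosed {g : S |
        ‖embedding ρ hmeas hK ((g : H) - approximant lam e m X g)‖ₑ ^ 2 ≤ c} := by
      refine isClosed_le ?_ continuous_const
      have h1 : Continuous fun g : H => embedding ρ hmeas hK (g - approximant lam e m X g) :=
        (embedding ρ hmeas hK).continuous.comp (continuous_id.sub (continuous_approximant m X))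
      exact (ENNReal.continuous_pow 2).comp (h1.comp continuous_subtype_val).enorm
    exact (TopologicalSpace.denseRange_denseSeq S).induction_on (p := fun g : S =>
      ‖embedding ρ hmeas hK ((g : H) - approximant lam e m X g)‖ₑ ^ 2 ≤ c) ⟨f, hf⟩ hcl h
  rw [heq]
  refine NullMeasurableSet.inter ?_ (NullMeasurableSet.iInter fun j => ?_)
  · exact (nullMeasurableSet_eq_fun (aemeasurable_det (lam := lam) (e := e) hmeas m n)
      aemeasurable_const).compl
  · exact nullMeasurableSet_le (aemeasurable_enorm_error m n _) aemeasurable_const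

end Error

/-- The lower bound 21 is all that the error estimate requires of `C`: it splits as 1 for the
projection error and 20 for the fit. -/
theorem constC_bounds : 21 ≤ constC ∧ constC < 28.05 := by
  have h2 : √2 ^ 2 = 2 := Real.sq_sqrt (by norm_num)
  have hs1 : 1.41 ≤ √2 := Real.le_sqrt_of_sq_le (by norm_num)
  have hs2 : √2 ≤ 1.41422 := Real.sqrt_le_iff.2 ⟨by norm_num, by norm_num⟩
  have hlog : 2.0794 ≤ Real.log 8 := by
    rw [show (8 : ℝ) = 2 ^ 3 by norm_num, Real.log_pow]
    have := Real.log_two_gt_d9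
    norm_num at this ⊢
    linarith
  have hs3 : 2.039 ≤ √(2 * Real.log 8) := Real.le_sqrt_of_sq_le (by norm_num at hlog ⊢; linarith)
  have hi : 1 / (4 * √(2 * Real.log 8)) ≤ 0.12262 := by
    rw [div_le_iff₀ (by positivity)]
    norm_num at hs3 ⊢
    linarith
  have hi0 : 0 ≤ 1 / (4 * √(2 * Real.log 8)) := by positivity
  have hR1 : 1.41 ≤ constR := by rw [constR]; linarith
  have hR2 : constR ≤ 1.53684 := by rw [constR]; norm_num at hs2 hi ⊢; linarith
  constructor
  · rw [constC]
    norm_num at hR1 ⊢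
    nlinarith
  · rw [constC]
    norm_num at hR1 hR2 ⊢
    nlinarith

/-! ### Probabilities of the two exceptional sets. -/

section Probability

variable {D H : Type*} [NormedAddCommGroup H] [InnerProductSpace ℂ H] [CompleteSpace H]
  [RKHS ℂ H D ℂ] [MeasurableSpace D] {ρ : Measure D} [IsProbabilityMeasure ρ]
  {hmeas : ∀ f : H, AEStronglyMeasurable f ρ} {hK : IsBoundedKernel H}
  {lam : ℕ → ℝ} {e : ℕ → H}

/-- The tail of the sampling operator is bounded with high probability. -/
theorem IsEigensystem.measureReal_tail_le (he : IsEigensystem (gramOperator ρ hmeas hK) lam e)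
    (m : ℕ) {n : ℕ} (hn : 1 ≤ n) {V : ℝ} (hV : n * lam (m - 1) ≤ V)
    (hTV : tailFunction (D := D) e m * Real.log (8 * n) ≤ V) {δ : ℝ} (hδ₀ : 0 < δ) (hδ₁ : δ < 1) :
    (Measure.pi fun _ : Fin n => ρ).real {X | ¬ ∀ (M : ℕ) (c : Fin M → ℂ),
      ∑ i, ‖∑ k, star (c k) * e (m - 1 + k) (X i)‖ ^ 2 ≤ 10 * V / δ * ∑ k, ‖c k‖ ^ 2} ≤ δ := by
  have hn' : (1 : ℝ) ≤ n := by exact_mod_cast hn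
  have hT0 : 0 ≤ tailFunction (D := D) e m :=
    Real.iSup_nonneg fun x => tsum_nonneg fun k => by positivity
  have hlog : 0 < Real.log (8 * n) := Real.log_pos (by linarith)
  have hV0 : 0 ≤ V := (mul_nonneg hT0 hlog.le).trans hTV
  have hδV : 0 ≤ 10 * V / δ := by positivity
  set A : ℕ → Set (Fin n → D) := fun M => {X | ¬ ∀ c : Fin M → ℂ,
    ∑ i, ‖∑ k, star (c k) * e (m - 1 + k) (X i)‖ ^ 2 ≤ 10 * V / δ * ∑ k, ‖c k‖ ^ 2} with hA
  have hAM : ∀ M, (Measure.pi fun _ : Fin n => ρ) (A M) ≤ ENNReal.ofReal δ := by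
    intro M
    have hsys := he.tail_isBoundedSystem m M
    -- The tail bound requires `V > 0`. If `V = 0`, then `T(m) = 0`, so the tail eigenfunctions
    -- vanish at every point and the set is empty.
    rcases hV0.eq_or_lt with h0 | h0
    · have hT : tailFunction (D := D) e m ≤ 0 := by
        by_contra hcon
        have := mul_pos (not_le.1 hcon) hlog
        linarith
      have : A M = ∅ := by
        refine Set.eq_empty_of_forall_notMem fun X hX => hX fun c => ?_
        have hz : ∀ i (k : Fin M), e (m - 1 + k) (X i) = 0 := by
          intro i k
          have h1 := (Finset.single_le_sum (f := fun k : Fin M => ‖e (m - 1 + k) (X i)‖ ^ 2)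
            (fun k _ => by positivity) (Finset.mem_univ k)).trans ((hsys.sum_le (X i)).trans hT)
          have h2 := pow_eq_zero_iff two_ne_zero |>.1 (le_antisymm h1 (by positivity))
          simpa using h2
        simp only [hz, mul_zero, Finset.sum_const_zero, norm_zero, ne_eq, OfNat.ofNat_ne_zero,
          not_false_eq_true, zero_pow]
        positivity
      rw [this]
      simp
    · have h1 := hsys.measureReal_upper_tail_le hT0 hn h0 (fun k => ?_) hTV hδ₀ hδ₁
      · rw [← ofReal_measureReal]
        exact ENNReal.ofReal_le_ofReal h1
      · exact (mul_le_mul_of_nonneg_left (he.antitone (by omega)) (by positivity)).trans hV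
  have hmono : Monotone A := by
    -- Padding a coefficient vector by zero makes the exceptional sets increase with `M`. Continuity
    -- from below then carries the uniform bound `δ` to their union.
    refine monotone_nat_of_le_succ fun M X hX hcon => hX fun c => ?_
    have := hcon (Fin.snoc c 0)
    simpa [Fin.sum_univ_castSucc] using this
  have hU : {X : Fin n → D | ¬ ∀ (M : ℕ) (c : Fin M → ℂ),
      ∑ i, ‖∑ k, star (c k) * e (m - 1 + k) (X i)‖ ^ 2 ≤ 10 * V / δ * ∑ k, ‖c k‖ ^ 2} =
      ⋃ M, A M := by
    ext X
    simp only [hA, Set.mem_iUnion, Set.mem_ofPred_eq, not_forall]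
  rw [hU, measureReal_def]
  refine ENNReal.toReal_le_of_le_ofReal hδ₀.le ?_
  rw [hmono.measure_iUnion]
  exact iSup_le hAM

theorem IsEigensystem.measureReal_sampleMatrix_le
    (he : IsEigensystem (gramOperator ρ hmeas hK) lam e) {m n : ℕ} (hn : 1 ≤ n)
    (hpos : ∀ k : ℕ, k + 1 < m → 0 < lam k) {δ : ℝ} (hδ₀ : 0 < δ) (hδ₁ : δ < 1)
    (hN : spectralFunction (D := D) lam e m ≤
      (n : ℝ) / (48 * (√2 * Real.log (2 * (n : ℝ)) - Real.log δ))) :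
    (Measure.pi fun _ : Fin n => ρ).real {X | ¬ ∀ c : Fin (m - 1) → ℂ,
      (n : ℝ) / 2 * ∑ k, ‖c k‖ ^ 2 ≤ ∑ i, ‖(sampleMatrix lam e m X *ᵥ c) i‖ ^ 2} ≤ 2 * δ := by
  have hsys := he.eta_isBoundedSystem m hpos
  have hN0 : 0 ≤ spectralFunction (D := D) lam e m :=
    Real.iSup_nonneg fun x => Finset.sum_nonneg fun k _ => by positivity
  refine le_trans (measureReal_mono ?_) (hsys.measureReal_lower_tail_le hN0 hn hδ₀ hδ₁ hN)
  intro X hX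
  rw [Set.mem_ofPred_eq] at hX ⊢
  refine fun hcon => hX fun c => ?_
  -- The quadratic form of the sample sum carries conjugated coefficients.
  have := hcon (star c)
  simp only [Pi.star_apply, norm_star, star_star] at this
  simpa only [Matrix.mulVec, dotProduct, sampleMatrix, Matrix.of_apply, mul_comm] using this

end Probability
end RKHSLeastSquares

/-! ### Assembly of the error bound and the probabilities. -/

open RKHSLeastSquares in
/-- The nodes `X = (x¹, …, xⁿ)` are distributed according to the `n`-fold product measure of `ρ`.
The event asserts that the least squares problem is uniquely solvable (so that the algorithm is
applicable) and that the error bound holds. The singular number `σ_m` is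
`singularNumber lam (m - 1)`, since the sequences `lam` and `e` are indexed from `0`. -/
theorem corollary5p5 {D H : Type*} [MeasurableSpace D]
    [NormedAddCommGroup H] [InnerProductSpace ℂ H] [CompleteSpace H] [RKHS ℂ H D ℂ]
    [TopologicalSpace.SeparableSpace H]
    (ρ : Measure D) [IsProbabilityMeasure ρ]
    (hmeas : ∀ f : H, AEStronglyMeasurable f ρ)
    (hK : IsBoundedKernel H)
    (lam : ℕ → ℝ) (e : ℕ → H)
    (he : IsEigensystem (gramOperator ρ hmeas hK) lam e)
    (n m : ℕ) (hn : 1 ≤ n) (hm : 1 ≤ m)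
    (hpos : ∀ k : ℕ, k + 1 < m → 0 < lam k)
    (δ : ℝ) (hδ₀ : 0 < δ) (hδ₁ : δ < 1)
    (hN : spectralFunction lam e m ≤
      (n : ℝ) / (48 * (√2 * Real.log (2 * (n : ℝ)) - Real.log δ))) :
    constC < 28.05 ∧
    NullMeasurableSet
      {X : Fin n → D | (sampleMatrix lam e m X).rank = m - 1 ∧
        worstCaseErrorSq ρ hmeas hK lam e m X ≤
          ENNReal.ofReal (constC / δ * max (singularNumber lam (m - 1) ^ 2)
            (Real.log (8 * (n : ℝ)) / (n : ℝ) * tailFunction e m))}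
      (Measure.pi fun _ : Fin n => ρ) ∧
    1 - 3 * δ ≤ (Measure.pi fun _ : Fin n => ρ).real
      {X : Fin n → D | (sampleMatrix lam e m X).rank = m - 1 ∧
        worstCaseErrorSq ρ hmeas hK lam e m X ≤
          ENNReal.ofReal (constC / δ * max (singularNumber lam (m - 1) ^ 2)
            (Real.log (8 * (n : ℝ)) / (n : ℝ) * tailFunction e m))} := by
  obtain ⟨hC1, hC2⟩ := constC_bounds
  refine ⟨hC2, nullMeasurableSet_event m n _, ?_⟩
  set μ := Measure.pi fun _ : Fin n => ρ with hμ
  set Q := max (singularNumber lam (m - 1) ^ 2)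
    (Real.log (8 * (n : ℝ)) / (n : ℝ) * tailFunction (D := D) e m) with hQ
  have hn' : (1 : ℝ) ≤ n := by exact_mod_cast hn
  have hlamQ : lam (m - 1) ≤ Q := by
    have h1 : singularNumber lam (m - 1) ^ 2 = lam (m - 1) := Real.sq_sqrt (he.nonneg _)
    rw [← h1]
    exact le_max_left _ _
  have hQ0 : 0 ≤ Q := (he.nonneg _).trans hlamQ
  have hTQ : tailFunction (D := D) e m * Real.log (8 * n) ≤ n * Q := by
    have h1 : Real.log (8 * (n : ℝ)) / (n : ℝ) * tailFunction (D := D) e m ≤ Q := le_max_right _ _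
    rw [div_mul_eq_mul_div, div_le_iff₀ (by linarith)] at h1
    linarith
  have hA1 := he.measureReal_sampleMatrix_le hn hpos hδ₀ hδ₁ hN
  have hA2 := he.measureReal_tail_le m hn (V := n * Q)
    (mul_le_mul_of_nonneg_left hlamQ (by linarith)) hTQ hδ₀ hδ₁
  have hA0 : μ.real {X | ¬ ∀ f : H, gramOperator ρ hmeas hK f = 0 → ∀ i, f (X i) = 0} = 0 := by
    rw [measureReal_def, ae_iff.1 (ae_forall_gramOperator_eq_zero n)]
    rfl
  set A₀ := {X : Fin n → D | ¬ ∀ f : H, gramOperator ρ hmeas hK f = 0 → ∀ i, f (X i) = 0} with hA₀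
  set A₁ := {X : Fin n → D | ¬ ∀ c : Fin (m - 1) → ℂ, (n : ℝ) / 2 * ∑ k, ‖c k‖ ^ 2 ≤
    ∑ i, ‖(sampleMatrix lam e m X *ᵥ c) i‖ ^ 2} with hA₁
  set A₂ := {X : Fin n → D | ¬ ∀ (M : ℕ) (c : Fin M → ℂ),
    ∑ i, ‖∑ k, star (c k) * e (m - 1 + k) (X i)‖ ^ 2 ≤ 10 * (n * Q) / δ * ∑ k, ‖c k‖ ^ 2} with hA₂
  set F := {X : Fin n → D | (sampleMatrix lam e m X).rank = m - 1 ∧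
    worstCaseErrorSq ρ hmeas hK lam e m X ≤ ENNReal.ofReal (constC / δ * Q)} with hF
  -- Outside a null set and two exceptional sets of measure at most `2δ` and `δ`, the deterministic
  -- estimate applies. Subadditivity needs no measurability of these sets.
  have hcover : (Set.univ : Set (Fin n → D)) ⊆ F ∪ (A₀ ∪ (A₁ ∪ A₂)) := by
    intro X _
    by_contra hX
    simp only [Set.mem_union, not_or] at hX
    obtain ⟨hXF, h0, h1, h2⟩ := hX
    rw [hA₀, Set.mem_ofPred_eq, not_not] at h0
    rw [hA₁, Set.mem_ofPred_eq, not_not] at h1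
    rw [hA₂, Set.mem_ofPred_eq, not_not] at h2
    refine hXF ⟨(rank_eq_iff_det_ne_zero _).2 (det_ne_zero_of_le (by positivity) h1), ?_⟩
    rw [worstCaseErrorSq_le_iff]
    intro f hf
    have h3 := he.norm_sub_approximant_sq_le hpos (by positivity) (by positivity) h0 h1 h2 hf
    rw [← ofReal_norm, ← ENNReal.ofReal_pow (norm_nonneg _)]
    refine ENNReal.ofReal_le_ofReal (h3.trans ?_)
    -- This is `t / a`: the upper sampling bound divided by the lower bound on `L* L`.
    have h4 : 10 * (n * Q) / δ / (n / 2) = 20 / δ * Q := by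
      field_simp
      ring
    have h5 : Q ≤ 1 / δ * Q := le_mul_of_one_le_left hQ0 (by rw [le_div_iff₀ hδ₀]; linarith)
    have h6 : 21 / δ * Q ≤ constC / δ * Q := by gcongr
    have h7 : 21 / δ * Q = 1 / δ * Q + 20 / δ * Q := by ring
    rw [h4]
    linarith
  have h1 : μ.real Set.univ ≤ μ.real F + (μ.real A₀ + (μ.real A₁ + μ.real A₂)) :=
    (measureReal_mono hcover).trans ((measureReal_union_le _ _).trans
      (add_le_add_right ((measureReal_union_le _ _).trans
        (add_le_add_right (measureReal_union_le _ _) _)) _))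
  rw [probReal_univ] at h1
  linarith
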